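/- Let $n\ge 0$ and let $G$ be a loopless connected signed graph on the vertex set $[n+1]=\{1,\dots,n+1\}$ (multiple edges allowed): each edge is $(i,j,-)$ or $(i,j,+)$ with $i<j$. To $(i,j,\pm)$ associate the vector $e_i\pm e_j$, and let $M_G$ be the $(n+1)\times \#E(G)$ matrix with these vectors as columns. For $a\in\mathbb Z^{n+1}$ the flow polytope is $\mathcal F_G(a)=\{f\in\mathbb R_{\ge 0}^{E(G)} : M_Gf=a\}$. Let $\mathrm{indeg}_G(i)$ be the number of negative edges $(\cdot,i,-)$, and put $d_i=\mathrm{indeg}_G(i)-1$ for $2\le i\le n+1$. Assume that $\mathrm{indeg}_G(i)\ge 1$ for all $2\le i\le n+1$ and that $\#E(G)\ge n+1$. An integer dynamic $a$-flow on $G$ assigns to each negative edge $e$ an integer $b(e)\ge 0$ and to each positive edge $e=(i,j,+)$ an integer $b_\ell(e)\ge 0$ (on a left half-edge at $i$) together with integers $b_{r,0}(e),b_{r,1}(e),\dots,b_{r,b_\ell(e)}(e)\ge 0$ (on the original right half-edge at $j$ and on $b_\ell(e)$ extra right half-edges at $j$), such that for every vertex $v$ $$\sum_{e=(\cdot,v,-)}b(e)+a_v=\sum_{e=(v,\cdot,-)}b(e)+\sum_{e=(v,\cdot,+)}b_\ell(e)+\sum_{e=(\cdot,v,+)}\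 \sum_{k=0}^{b_\ell(e)}b_{r,k}(e).$$ Let $K_G^{\mathrm{dyn}}(a)$ be the number of integer dynamic $a$-flows on $G$. Then $$\mathrm{vol}\,\mathcal F_G(2,0,\dots,0)=K_G^{\mathrm{dyn}}(0,d_2,\dots,d_n,d_{n+1}).$$ Here $\mathrm{vol}$ is the normalized volume with respect to the lattice $\ker M_G\cap\mathbb Z^{E(G)}$: with $d=\dim\ker M_G$, it is $d!$ times Lebesgue measure on translates of $\ker M_G$, scaled so that a fundamental parallelepiped of that lattice has measure $1$ (it is $0$ if $\mathcal F_G(2,0,\dots,0)$ is empty or has dimension less than $d$). Moreover, if $\mathcal F_G(2,0,\dots,0)$ has dimension $\#E(G)-(n+1)$, the same equality holds with the normalized volume taken intrinsically, with respect to the lattice of integer points parallel to the polytope's own affine span. -/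

import Mathlib

open scoped ENNReal Nat Matrix

noncomputable section

/-- A signed multigraph on the vertices `Fin (n + 1)` (the vertices `1, …, n + 1` shifted by one),
with edges labelled by `E`. The edge `e` is `(src e, tgt e, sign e)`, where `src e ≤ tgt e`
and `sign e` is `1` or `-1`. Multiple edges are allowed, and so are loops,
which are always positive. -/
structure SignedGraph (n : ℕ) (E : Type*) where
  src : E → Fin (n + 1)
  tgt : E → Fin (n + 1)
  sign : E → ℤˣ
  src_le_tgt : ∀ e, src e ≤ tgt e
  sign_of_loop : ∀ e, src e = tgt e → sign e = 1

namespace SignedGraph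

variable {n : ℕ} {E : Type*}

/-- No edge is a loop. -/
def Loopless (G : SignedGraph n E) : Prop :=
  ∀ e, G.src e ≠ G.tgt e

/-- The underlying graph (signs forgotten) is connected. -/
def Connected (G : SignedGraph n E) : Prop :=
  (SimpleGraph.fromRel fun i j => ∃ e, G.src e = i ∧ G.tgt e = j).Connected

/-- The indegree of `v`: the number of negative edges `(·, v, -)`. -/
def indeg (G : SignedGraph n E) (v : Fin (n + 1)) : ℕ :=
  Nat.card {e : E // G.sign e = -1 ∧ G.tgt e = v}

/-- The positive root of an edge: `(i, j, -)` gives `e_i - e_j`, `(i, j, +)` gives `e_i + e_j`;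
in particular a loop `(i, i, +)` gives `2 e_i`. -/
def root (G : SignedGraph n E) (e : E) : Fin (n + 1) → ℤ :=
  Pi.single (G.src e) 1 + (G.sign e : ℤ) • Pi.single (G.tgt e) 1

/-- The real matrix whose columns are the roots of the edges. -/
def rootMatrix (G : SignedGraph n E) : Matrix (Fin (n + 1)) E ℝ :=
  Matrix.of fun v e => (G.root e v : ℝ)

/-- The flow polytope of `G` with netflow `a`: all nonnegative real vectors `f`, indexed by the
edges, with `M_G f = a`. -/
def flowPolytope [Fintype E] (G : SignedGraph n E) (a : Fin (n + 1) → ℤ) : Set (E → ℝ) :=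
  {f | (∀ e, 0 ≤ f e) ∧ G.rootMatrix *ᵥ f = fun v => (a v : ℝ)}

/-- The space of real flows with netflow zero, that is, the kernel of `M_G`. Every flow polytope
of `G` lies in a translate of it. -/
def flowSpace [Fintype E] (G : SignedGraph n E) : Submodule ℝ (E → ℝ) :=
  LinearMap.ker G.rootMatrix.mulVecLin

/-- An integer dynamic flow on `G` with netflow `a`. A positive edge `(i, j, +)` is split into a
left half at `i` and a right half at `j`; when the left half carries `left e` units of flow,
`left e` extra right half-edges appear at `j`, and each of them also carries a flow. -/
structure DynamicFlow [Fintype E] (G : SignedGraph n E) (a : Fin (n + 1) → ℤ) where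
  /-- flow on the negative edges -/
  flow : {e : E // G.sign e = -1} → ℕ
  /-- flow on the left half of a positive edge -/
  left : {e : E // G.sign e = 1} → ℕ
  /-- flow on the original right half of a positive edge -/
  right : {e : E // G.sign e = 1} → ℕ
  /-- flow on the extra right half-edges that a positive edge creates -/
  extra : (e : {e : E // G.sign e = 1}) → Fin (left e) → ℕ
  /-- incoming flow plus netflow equals outgoing flow at every vertex -/
  conservation : ∀ v : Fin (n + 1),
    ((∑ e : {e : E // G.sign e = -1}, if G.tgt e = v then flow e else 0 : ℕ) : ℤ) + a v =
      ((∑ e : {e : E // G.sign e = -1}, if G.src e = v then flow e else 0 : ℕ) : ℤ)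
      + ((∑ e : {e : E // G.sign e = 1}, if G.src e = v then left e else 0 : ℕ) : ℤ)
      + ((∑ e : {e : E // G.sign e = 1}, if G.tgt e = v then right e else 0 : ℕ) : ℤ)
      + ((∑ e : {e : E // G.sign e = 1},
          if G.tgt e = v then ∑ k : Fin (left e), extra e k else 0 : ℕ) : ℤ)

/-- The dynamic Kostant partition function: the number of integer dynamic flows with
netflow `a`. -/
def dynamicKostant [Fintype E] (G : SignedGraph n E) (a : Fin (n + 1) → ℤ) : ℕ∞ :=
  ENat.card (G.DynamicFlow a)

/-- The netflow vector `(0, d_2, …, d_{n+1})` with `d_i = indeg i - 1`. -/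
def shiftedIndeg (G : SignedGraph n E) : Fin (n + 1) → ℤ :=
  fun i => if i = 0 then 0 else (G.indeg i : ℤ) - 1

end SignedGraph

section NormalizedVolume

variable {ι : Type*}

/-- The inclusion of the integer points into real space. -/
def intVec : (ι → ℤ) →ₗ[ℤ] (ι → ℝ) :=
  (Int.castAddHom ℝ).toIntLinearMap.compLeft ι

/-- The lattice of integer points of a linear subspace. -/
def integerPoints (V : Submodule ℝ (ι → ℝ)) : Submodule ℤ (ι → ℤ) :=
  (V.restrictScalars ℤ).comap intVec

/-- The normalized volume of a set `P` lying in a translate of a rational subspace `V`: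
with `d = dim V`, it is `d!` times the Lebesgue measure of `P` in the coordinates given by a
`ℤ`-basis of the lattice of integer points of `V`, so that a unimodular `d`-simplex has volume `1`.
It depends neither on the lattice basis nor on the base point in `P`.
It is `0` if `P` spans less than a translate of `V`. -/
def normalizedVolumeIn [Fintype ι] (V : Submodule ℝ (ι → ℝ)) (P : Set (ι → ℝ)) : ℝ≥0∞ :=
  open Classical in
  if h : P.Nonempty then
    ((Module.finrank ℤ (integerPoints V))! : ℝ≥0∞) *
      MeasureTheory.volume {y : Fin (Module.finrank ℤ (integerPoints V)) → ℝ |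
        h.some + ∑ k, y k • intVec (Module.finBasis ℤ (integerPoints V) k : ι → ℤ) ∈ P}
  else 0

/-- The normalized volume of a polytope with respect to the lattice of its own affine span. -/
def normalizedVolume [Fintype ι] (P : Set (ι → ℝ)) : ℝ≥0∞ :=
  normalizedVolumeIn (vectorSpan ℝ P) P

end NormalizedVolume

end

/-! Summing the netflow equations kills negative edges and counts positive edges twice. So the
polytope consists of the nonnegative flows conserved at all vertices but the first whose positive
edges carry total flow 1 (`mem_flowPolytope_iff`). It is a slice of the cone of nonnegative
conserved flows. The proof evaluates the integral of `exp (-a)` over this cone in two ways, where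
`a` is the total flow on the positive edges.

Slicing: with `r` the rank of the lattice of netflow-zero integer flows, the slice at height `a > 0`
is `a` times the slice at height 1, so its volume is `a ^ r` times that of the latter. Since `∫ exp
(-a) a ^ r = r!`, the integral is the normalized volume (`lmarginal_freeEdges_eq`).

Elimination: choose one negative edge into each vertex but the first, the parent edge. The other
edges are free coordinates, and conservation recovers the parents with integer coefficients, so the
lattice measure is Lebesgue measure in these coordinates. Integrate out the free negative edges
vertex by vertex in increasing order. If the edges into `v` carry weights `x ^ b / b!`, the simplex
integral gives `X ^ c / c!`, where `c + 1` is the sum of the `b + 1` and `X` is the total outflow at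
`v`. The multinomial theorem distributes `c` over the outgoing half-edges, and `c` exceeds the
incoming sum of `b` by `indeg v - 1`: this is the conservation law of a dynamic flow
(`lmarginal_flowDensity`, `isPartialFlow_succ`).

At the end a positive edge with exponents `l`, `r` on its halves contributes `∫ exp (-x) (x ^ l /
l!) (x ^ r / r!) = (l + r).choose l`. This is the number of ways to spread `r` over the original
right half and `l` extra ones, so the sum counts dynamic flows (`dynamicKostant_eq_sum`).

Without positive edges the polytope is empty, and there is no dynamic flow for lack of balance. For
the intrinsic volume, the dimension hypothesis forces the span of the polytope to be all of
`flowSpace`. -/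

noncomputable section

/-! ### Half-edges, conservation and netflow. -/

namespace SignedGraph

variable {n : ℕ} {E : Type*}

/-- The outgoing half-edges: the left half of every edge, sitting at its source, and the right half
of every positive edge, sitting at its target. -/
abbrev HalfEdge (G : SignedGraph n E) : Type _ := E ⊕ {e : E // G.sign e = 1}

/-- The edge containing a half-edge. -/
def edge (G : SignedGraph n E) : G.HalfEdge → E := Sum.elim id Subtype.val

/-- The vertex at which a half-edge sits. -/
def vertex (G : SignedGraph n E) : G.HalfEdge → Fin (n + 1) :=
  Sum.elim G.src fun e => G.tgt e

variable {G : SignedGraph n E}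

lemma sign_eq_neg_one_iff {e : E} : G.sign e = -1 ↔ G.sign e ≠ 1 := by
  rcases Int.units_eq_one_or (G.sign e) with h | h <;> rw [h] <;> decide

lemma Loopless.src_lt_tgt (hloop : G.Loopless) (e : E) : G.src e < G.tgt e :=
  lt_of_le_of_ne (G.src_le_tgt e) (hloop e)

/-- An edge of an outgoing half-edge at `v` is positive or enters a later vertex. -/
lemma Loopless.pos_or_lt (hloop : G.Loopless) {h : G.HalfEdge} {v : Fin (n + 1)}
    (hh : G.vertex h = v) : G.sign (G.edge h) = 1 ∨ v < G.tgt (G.edge h) := by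
  rcases h with e | e
  · right
    subst hh
    exact hloop.src_lt_tgt e
  · exact Or.inl e.2

variable [Fintype E] (G)

open Classical in
/-- The negative edges entering `v`. -/
def inEdges (v : Fin (n + 1)) : Finset E :=
  Finset.univ.filter fun e => G.sign e = -1 ∧ G.tgt e = v

/-- The half-edges sitting at `v`. -/
def outHalves (v : Fin (n + 1)) : Finset G.HalfEdge :=
  Finset.univ.filter fun h => G.vertex h = v

/-- The positive edges. -/
def posEdges : Finset E :=
  Finset.univ.filter fun e => G.sign e = 1

/-- Conservation of flow at all vertices but the first. -/
def IsConserved {R : Type*} [AddCommMonoid R] (f : E → R) : Prop :=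
  ∀ v, v ≠ 0 → ∑ e ∈ G.inEdges v, f e = ∑ h ∈ G.outHalves v, f (G.edge h)

/-- A choice of an incoming negative edge at every vertex but the first. -/
def IsParentChoice (t : Fin (n + 1) → E) : Prop :=
  ∀ v, v ≠ 0 → t v ∈ G.inEdges v

open Classical in
/-- The edges not chosen as parents. -/
def freeEdges (_G : SignedGraph n E) (t : Fin (n + 1) → E) : Finset E :=
  Finset.univ.filter fun e => ∀ v, v ≠ 0 → e ≠ t v

variable {G : SignedGraph n E}

@[simp] lemma mem_inEdges {v : Fin (n + 1)} {e : E} :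
    e ∈ G.inEdges v ↔ G.sign e = -1 ∧ G.tgt e = v := by simp [inEdges]

@[simp] lemma mem_outHalves {v : Fin (n + 1)} {h : G.HalfEdge} :
    h ∈ G.outHalves v ↔ G.vertex h = v := by simp [outHalves]

@[simp] lemma mem_posEdges {e : E} : e ∈ G.posEdges ↔ G.sign e = 1 := by simp [posEdges]

@[simp] lemma mem_freeEdges {t : Fin (n + 1) → E} {e : E} :
    e ∈ G.freeEdges t ↔ ∀ v, v ≠ 0 → e ≠ t v := by simp [freeEdges]

lemma sum_outHalves {R : Type*} [AddCommMonoid R] (f : G.HalfEdge → R) (v : Fin (n + 1)) :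
    ∑ h ∈ G.outHalves v, f h = (∑ e, if G.src e = v then f (Sum.inl e) else 0) +
      ∑ e : {e : E // G.sign e = 1}, if G.tgt e = v then f (Sum.inr e) else 0 := by
  rw [outHalves, Finset.sum_filter, Fintype.sum_sum_type]
  rfl

lemma sum_posEdges {R : Type*} [AddCommMonoid R] (f : E → R) :
    ∑ e ∈ G.posEdges, f e = ∑ e, if G.sign e = 1 then f e else 0 := by
  rw [posEdges, Finset.sum_filter]

lemma sum_posSubtype {R : Type*} [AddCommMonoid R] (f : E → R) :
    ∑ e : {e : E // G.sign e = 1}, f e = ∑ e, if G.sign e = 1 then f e else 0 := by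
  rw [← sum_posEdges]
  exact (Finset.sum_subtype _ (fun _ => mem_posEdges) f).symm

lemma sum_negSubtype {R : Type*} [AddCommMonoid R] (f : E → R) :
    ∑ e : {e : E // G.sign e = -1}, f e = ∑ e, if G.sign e = -1 then f e else 0 := by
  rw [← Finset.sum_filter]
  exact (Finset.sum_subtype _ (fun _ => by simp) f).symm

lemma sum_inEdges {R : Type*} [AddCommMonoid R] (f : E → R) (v : Fin (n + 1)) :
    ∑ e ∈ G.inEdges v, f e = ∑ e, if G.sign e = -1 ∧ G.tgt e = v then f e else 0 := by
  classical
  rw [inEdges, Finset.sum_filter]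

lemma rootMatrix_mulVec (f : E → ℝ) (v : Fin (n + 1)) :
    (G.rootMatrix *ᵥ f) v =
      ∑ h ∈ G.outHalves v, f (G.edge h) - ∑ e ∈ G.inEdges v, f e := by
  rw [sum_outHalves, sum_inEdges]
  simp only [edge, Sum.elim_inl, Sum.elim_inr, id]
  rw [sum_posSubtype (fun e => if G.tgt e = v then f e else 0), ← Finset.sum_add_distrib,
    ← Finset.sum_sub_distrib]
  refine Finset.sum_congr rfl fun e _ => ?_
  simp only [rootMatrix, root, Matrix.of_apply, Pi.add_apply, Pi.smul_apply, Pi.single_apply,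
    eq_comm (a := v)]
  rcases Int.units_eq_one_or (G.sign e) with h | h <;> rw [h] <;>
    by_cases h1 : G.src e = v <;> by_cases h2 : G.tgt e = v <;> simp [h1, h2] <;> ring

/-- The coordinates of a negative root sum to 0, those of a positive root to 2. -/
lemma sum_rootMatrix_mulVec (f : E → ℝ) :
    ∑ v, (G.rootMatrix *ᵥ f) v = 2 * ∑ e ∈ G.posEdges, f e := by
  simp only [Matrix.mulVec, dotProduct]
  rw [Finset.sum_comm, sum_posEdges, Finset.mul_sum]
  refine Finset.sum_congr rfl fun e _ => ?_
  rw [← Finset.sum_mul]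
  simp only [rootMatrix, root, Matrix.of_apply, Pi.add_apply, Pi.smul_apply, Pi.single_apply]
  rcases Int.units_eq_one_or (G.sign e) with h | h <;> rw [h] <;>
    simp [Finset.sum_add_distrib]
  exact Or.inl (by norm_num)

lemma isConserved_iff {f : E → ℝ} :
    G.IsConserved f ↔ ∀ v, v ≠ 0 → (G.rootMatrix *ᵥ f) v = 0 := by
  refine forall_congr' fun v => imp_congr_right fun _ => ?_
  rw [rootMatrix_mulVec, sub_eq_zero, eq_comm]

/-- Once the other netflows vanish, the netflow at the first vertex is the sum of all netflows,
which is twice the positive total. -/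
lemma mulVec_eq_single_iff {f : E → ℝ} {c : ℝ} :
    G.rootMatrix *ᵥ f = Pi.single 0 (2 * c) ↔ G.IsConserved f ∧ ∑ e ∈ G.posEdges, f e = c := by
  have key := sum_rootMatrix_mulVec (G := G) f
  constructor
  · intro h
    refine ⟨isConserved_iff.2 fun v hv => by rw [h, Pi.single_eq_of_ne hv], ?_⟩
    rw [h, Finset.sum_pi_single'] at key
    simpa using key.symm
  · rintro ⟨h, rfl⟩
    rw [isConserved_iff] at h
    rw [Finset.sum_eq_single 0 (fun v _ hv => h v hv) (by simp)] at key
    funext v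
    by_cases hv : v = 0
    · subst hv; rw [key, Pi.single_eq_same]
    · rw [h v hv, Pi.single_eq_of_ne hv]

lemma mem_flowPolytope_iff {f : E → ℝ} :
    f ∈ G.flowPolytope (Pi.single 0 2) ↔
      (∀ e, 0 ≤ f e) ∧ G.IsConserved f ∧ ∑ e ∈ G.posEdges, f e = 1 := by
  rw [← mulVec_eq_single_iff]
  refine and_congr_right fun _ => ?_
  have : (fun v => ((Pi.single 0 2 : Fin (n + 1) → ℤ) v : ℝ)) = Pi.single 0 (2 * 1) := by
    funext v
    by_cases hv : v = 0
    · subst hv; simp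
    · simp [Pi.single_eq_of_ne hv]
  rw [this]

lemma mem_flowSpace_iff {f : E → ℝ} :
    f ∈ G.flowSpace ↔ G.IsConserved f ∧ ∑ e ∈ G.posEdges, f e = 0 := by
  rw [← mulVec_eq_single_iff, flowSpace, LinearMap.mem_ker, mul_zero, Pi.single_zero]
  rfl

/-! ### Conserved flows are determined by their free edges. -/

section Solve

variable {t : Fin (n + 1) → E}

lemma IsParentChoice.ne {v w : Fin (n + 1)} (ht : G.IsParentChoice t) (hv : v ≠ 0) (hw : w ≠ 0)
    (h : v ≠ w) : t v ≠ t w := by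
  intro h'
  have h1 := (mem_inEdges.1 (ht v hv)).2
  have h2 := (mem_inEdges.1 (ht w hw)).2
  exact h (by rw [← h1, ← h2, h'])

lemma IsParentChoice.mem_freeEdges_of_pos (ht : G.IsParentChoice t) {e : E} (he : G.sign e = 1) :
    e ∈ G.freeEdges t := by
  rw [mem_freeEdges]
  rintro v hv rfl
  exact sign_eq_neg_one_iff.1 (mem_inEdges.1 (ht v hv)).1 he

lemma IsParentChoice.mem_freeEdges_of_mem (ht : G.IsParentChoice t) {e : E} {v : Fin (n + 1)}
    (he : e ∈ G.inEdges v) (h : e ≠ t v) : e ∈ G.freeEdges t := by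
  rw [mem_freeEdges]
  rintro w hw rfl
  have h1 := (mem_inEdges.1 he).2
  have h2 := (mem_inEdges.1 (ht w hw)).2
  rw [← h1, h2] at h
  exact h rfl

/-- Going down from the last vertex, conservation at `w` is solved for the parent edge of `w`: all
other edges involved are free or enter later vertices. Only subtraction is used, so this works over
`ℤ` as well as over `ℝ`. -/
lemma exists_isConserved {R : Type*} [AddCommGroup R] (hloop : G.Loopless)
    (ht : G.IsParentChoice t) (y : E → R) :
    ∃ f, (∀ e ∈ G.freeEdges t, f e = y e) ∧ G.IsConserved f := by
  classical
  suffices H : ∀ k : ℕ, ∃ f : E → R, (∀ e ∈ G.freeEdges t, f e = y e) ∧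
      ∀ v : Fin (n + 1), v ≠ 0 → n + 1 ≤ v + k →
        ∑ e ∈ G.inEdges v, f e = ∑ h ∈ G.outHalves v, f (G.edge h) by
    obtain ⟨f, h1, h2⟩ := H (n + 1)
    exact ⟨f, h1, fun v hv => h2 v hv (by omega)⟩
  intro k
  induction k with
  | zero => exact ⟨y, fun _ _ => rfl, fun v _ h => absurd v.2 (by omega)⟩
  | succ k ih =>
    obtain ⟨f, h1, h2⟩ := ih
    by_cases hk : n ≤ k
    · refine ⟨f, h1, fun v hv _ => h2 v hv ?_⟩
      have : (v : ℕ) ≠ 0 := fun h => hv (Fin.ext h)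
      omega
    · let w : Fin (n + 1) := ⟨n - k, by omega⟩
      have hw : w ≠ 0 := fun h => by
        have : n - k = 0 := congrArg Fin.val h
        omega
      have htw := mem_inEdges.1 (ht w hw)
      -- The parent of `w` is negative and enters `w`, so it is not outgoing at any vertex from `w`
      -- on, and resetting it keeps the laws already achieved.
      have hout : ∀ v, w ≤ v → ∀ (c : R), ∑ h ∈ G.outHalves v, Function.update f (t w) c (G.edge h)
          = ∑ h ∈ G.outHalves v, f (G.edge h) := by
        intro v hv c
        refine Finset.sum_congr rfl fun h hh => Function.update_of_ne ?_ _ _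
        intro h'
        rcases hloop.pos_or_lt (mem_outHalves.1 hh) with h3 | h3
        · rw [h'] at h3
          exact sign_eq_neg_one_iff.1 htw.1 h3
        · rw [h', htw.2] at h3
          exact absurd h3 (not_lt.2 hv)
      refine ⟨Function.update f (t w) (∑ h ∈ G.outHalves w, f (G.edge h) -
        ∑ e ∈ (G.inEdges w).erase (t w), f e), ?_, ?_⟩
      · intro e he
        rw [Function.update_of_ne (mem_freeEdges.1 he w hw), h1 e he]
      · intro v hv hvk
        have hwv : w ≤ v := by
          rw [Fin.le_def]
          change n - k ≤ v
          omega
        rw [hout v hwv]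
        by_cases hvw : v = w
        · subst hvw
          rw [← Finset.add_sum_erase _ _ (ht w hw), Function.update_self]
          rw [Finset.sum_congr rfl fun e he =>
            Function.update_of_ne (Finset.ne_of_mem_erase he) _ _, sub_add_cancel]
        · rw [← h2 v hv]
          · refine Finset.sum_congr rfl fun e he => Function.update_of_ne ?_ _ _
            rintro rfl
            exact hvw ((mem_inEdges.1 he).2.symm.trans htw.2)
          · have : (v : ℕ) ≠ n - k := fun h => hvw (Fin.ext h)
            have : n - k ≤ (v : ℕ) := hwv
            omega

/-- Conserved flows agreeing on the free edges that are positive or enter a vertex beyond `k` agree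
on all edges that are positive or enter a vertex beyond `k`. -/
lemma IsConserved.eq_of_eq {R : Type*} [AddCommGroup R] (hloop : G.Loopless)
    (ht : G.IsParentChoice t) {f g : E → R} (hf : G.IsConserved f) (hg : G.IsConserved g) (k : ℕ)
    (h : ∀ e ∈ G.freeEdges t, (G.sign e = 1 ∨ k < (G.tgt e : ℕ)) → f e = g e)
    {e : E} (he : G.sign e = 1 ∨ k < (G.tgt e : ℕ)) : f e = g e := by
  classical
  -- Induction from the last target downwards: conservation at the target of a parent edge expresses
  -- it through free edges and edges with later targets.
  suffices H : ∀ j : ℕ, ∀ e : E, n + 1 ≤ G.tgt e + j → (G.sign e = 1 ∨ k < (G.tgt e : ℕ)) →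
      f e = g e from H (n + 1) e (by omega) he
  intro j
  induction j with
  | zero => exact fun e h => absurd (G.tgt e).2 (by omega)
  | succ j ih =>
    intro e hej he
    by_cases hfree : e ∈ G.freeEdges t
    · exact h e hfree he
    · rw [mem_freeEdges] at hfree
      push Not at hfree
      obtain ⟨v, hv, rfl⟩ := hfree
      have htv := mem_inEdges.1 (ht v hv)
      have hk : k < (v : ℕ) := by
        rcases he with he | he
        · exact absurd he (sign_eq_neg_one_iff.1 htv.1)
        · rwa [htv.2] at he
      rw [htv.2] at hej
      have h1 := hf v hv
      have h2 := hg v hv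
      rw [← Finset.add_sum_erase _ _ (ht v hv)] at h1 h2
      have h3 : ∑ e ∈ (G.inEdges v).erase (t v), f e = ∑ e ∈ (G.inEdges v).erase (t v), g e := by
        refine Finset.sum_congr rfl fun e he => ?_
        obtain ⟨he1, he2⟩ := Finset.mem_erase.1 he
        refine h e (ht.mem_freeEdges_of_mem he2 he1) (Or.inr ?_)
        rwa [(mem_inEdges.1 he2).2]
      have h4 : ∑ h ∈ G.outHalves v, f (G.edge h) = ∑ h ∈ G.outHalves v, g (G.edge h) := by
        refine Finset.sum_congr rfl fun h' hh => ?_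
        rcases hloop.pos_or_lt (mem_outHalves.1 hh) with h5 | h5
        · exact h _ (ht.mem_freeEdges_of_pos h5) (Or.inl h5)
        · rw [Fin.lt_def] at h5
          exact ih _ (by omega) (Or.inr (by omega))
      rw [h3, h4] at h1
      exact add_right_cancel (h1.trans h2.symm)

lemma IsConserved.ext {R : Type*} [AddCommGroup R] (hloop : G.Loopless)
    (ht : G.IsParentChoice t) {f g : E → R} (hf : G.IsConserved f) (hg : G.IsConserved g)
    (h : ∀ e ∈ G.freeEdges t, f e = g e) : f = g := by
  funext e
  -- In a loopless graph no edge has the first vertex as target, so `k = 0` covers every edge.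
  refine hf.eq_of_eq hloop ht hg 0 (fun e he _ => h e he) ?_
  right
  have := hloop.src_lt_tgt e
  rw [Fin.lt_def] at this
  omega

lemma exists_isParentChoice (hin : ∀ i : Fin (n + 1), i ≠ 0 → 1 ≤ G.indeg i) (e₀ : E) :
    ∃ t, G.IsParentChoice t := by
  classical
  have : ∀ i : Fin (n + 1), ∃ e, i ≠ 0 → e ∈ G.inEdges i := by
    intro i
    by_cases hi : i = 0
    · exact ⟨e₀, fun h => absurd hi h⟩
    · have h := hin i hi
      have : Nonempty {e : E // G.sign e = -1 ∧ G.tgt e = i} := by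
        by_contra hne
        rw [not_nonempty_iff] at hne
        rw [indeg, Nat.card_of_isEmpty] at h
        omega
      obtain ⟨e, he⟩ := this
      exact ⟨e, fun _ => mem_inEdges.2 he⟩
  choose t ht using this
  exact ⟨t, ht⟩

lemma card_inEdges (v : Fin (n + 1)) : (G.inEdges v).card = G.indeg v := by
  classical
  rw [indeg, Nat.card_eq_fintype_card, Fintype.card_subtype, inEdges]

lemma card_freeEdges (ht : G.IsParentChoice t) :
    (G.freeEdges t).card + n = Fintype.card E := by
  classical
  have h1 : G.freeEdges t = ((Finset.univ.erase 0).image t)ᶜ := by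
    ext e
    simp only [mem_freeEdges, Finset.mem_compl, Finset.mem_image, Finset.mem_erase,
      Finset.mem_univ, and_true, not_exists, not_and]
    exact forall_congr' fun v => imp_congr_right fun _ => ne_comm
  have h2 : ((Finset.univ.erase (0 : Fin (n + 1))).image t).card = n := by
    rw [Finset.card_image_of_injOn, Finset.card_erase_of_mem (Finset.mem_univ _)]
    · simp
    · intro v hv w hw h
      by_contra hne
      exact ht.ne (by simpa using hv) (by simpa using hw) hne h
  have h3 := Finset.card_compl_add_card ((Finset.univ.erase (0 : Fin (n + 1))).image t)
  rw [h2] at h3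
  rw [h1, h3]

end Solve

end SignedGraph

end

/-! ### Convolution and exponential integrals of the densities `x ^ b / b!`. -/

noncomputable section

open MeasureTheory

section PowerDensity

/-- The density `x ^ b / b!` on the nonnegative reals, extended by zero. -/
def powDensity (b : ℕ) (x : ℝ) : ℝ≥0∞ :=
  if 0 ≤ x then ENNReal.ofReal (x ^ b / b !) else 0

lemma powDensity_of_nonneg (b : ℕ) {x : ℝ} (hx : 0 ≤ x) :
    powDensity b x = ENNReal.ofReal (x ^ b / b !) := if_pos hx

lemma powDensity_of_neg (b : ℕ) {x : ℝ} (hx : x < 0) : powDensity b x = 0 := if_neg (not_le.2 hx)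

lemma powDensity_zero (x : ℝ) : powDensity 0 x = if 0 ≤ x then 1 else 0 := by
  simp [powDensity]

@[fun_prop]
lemma measurable_powDensity (b : ℕ) : Measurable (powDensity b) :=
  Measurable.ite measurableSet_Ici (by fun_prop) measurable_const

lemma lintegral_powDensity_zero (b : ℕ) (x : ℝ) :
    ∫⁻ y, powDensity b y * powDensity 0 (x - y) = powDensity (b + 1) x := by
  have h1 : ∀ y, powDensity b y * powDensity 0 (x - y) =
      (Set.Icc 0 x).indicator (fun y => ENNReal.ofReal (y ^ b / b !)) y := by
    intro y
    by_cases h0 : 0 ≤ y <;> by_cases h2 : y ≤ x <;>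
      simp [powDensity, Set.indicator, h0, h2]
  simp_rw [h1]
  rw [lintegral_indicator measurableSet_Icc]
  rcases le_or_gt 0 x with hx | hx
  · rw [powDensity_of_nonneg _ hx, ← ofReal_integral_eq_lintegral_ofReal]
    · rw [integral_Icc_eq_integral_Ioc, ← intervalIntegral.integral_of_le hx,
        intervalIntegral.integral_div, integral_pow, Nat.factorial_succ]
      congr 1
      push_cast
      field_simp
      simp
    · exact (Continuous.integrableOn_Icc (by fun_prop))
    · refine (ae_restrict_iff' measurableSet_Icc).2 (Filter.Eventually.of_forall fun y hy => ?_)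
      have := hy.1
      simp only [Pi.zero_apply]
      positivity
  · rw [Set.Icc_eq_empty (not_le.2 hx), powDensity_of_neg _ hx]
    simp

open scoped MeasureTheory in
-- Convolving with `powDensity 0` is integration from 0, which raises the exponent by one; the
-- general case follows by associativity.
lemma powDensity_lconvolution (a b : ℕ) :
    powDensity a ⋆ₗ[volume] powDensity b = powDensity (a + b + 1) := by
  have h0 : ∀ a, powDensity a ⋆ₗ[volume] powDensity 0 = powDensity (a + 1) := by
    intro a
    funext x
    rw [lconvolution_def, ← lintegral_powDensity_zero]
    simp_rw [neg_add_eq_sub]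
  induction b with
  | zero => exact h0 a
  | succ b ih =>
    rw [← h0 b, lconvolution_assoc (by fun_prop) (by fun_prop) (by fun_prop), ih, h0]
    rfl

lemma lintegral_powDensity_mul (a b : ℕ) (x : ℝ) :
    ∫⁻ y, powDensity a y * powDensity b (x - y) = powDensity (a + b + 1) x := by
  rw [← powDensity_lconvolution, lconvolution_def]
  simp_rw [neg_add_eq_sub]

/-- Integral of a monomial over a simplex. -/
lemma lmarginal_prod_powDensity {ι : Type*} [DecidableEq ι] (s : Finset ι) (b : ι → ℕ) (c : ℕ)
    (x : ℝ) (y₀ : ι → ℝ) :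
    lmarginal (fun _ : ι => (volume : Measure ℝ)) s
      (fun y => (∏ i ∈ s, powDensity (b i) (y i)) * powDensity c (x - ∑ i ∈ s, y i)) y₀ =
      powDensity (c + ∑ i ∈ s, (b i + 1)) x := by
  induction s using Finset.induction_on generalizing c with
  | empty => simp
  | insert i s hi ih =>
    rw [lmarginal_insert' _ (by fun_prop) hi, Finset.sum_insert hi,
      show c + (b i + 1 + ∑ i ∈ s, (b i + 1)) = (b i + c + 1) + ∑ i ∈ s, (b i + 1) by ring, ← ih]
    congr 1
    funext y
    rw [← lintegral_powDensity_mul, ← lintegral_const_mul _ (by fun_prop)]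
    refine lintegral_congr fun z => ?_
    have hne : ∀ j ∈ s, Function.update y i z j = y j := fun j hj =>
      Function.update_of_ne (ne_of_mem_of_not_mem hj hi) _ _
    rw [Finset.prod_insert hi, Finset.sum_insert hi, Function.update_self,
      Finset.sum_congr rfl hne, Finset.prod_congr rfl fun j hj => by rw [hne j hj],
      ← sub_sub, sub_right_comm]
    ring

/-- The multinomial theorem. -/
lemma powDensity_sum {ι : Type*} [DecidableEq ι] (s : Finset ι) (c : ℕ) (x : ι → ℝ) :
    powDensity c (∑ i ∈ s, x i) * ∏ i ∈ s, powDensity 0 (x i) =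
      ∑ b ∈ s.piAntidiag c, ∏ i ∈ s, powDensity (b i) (x i) := by
  by_cases hx : ∀ i ∈ s, 0 ≤ x i
  · have h1 : ∏ i ∈ s, powDensity 0 (x i) = 1 :=
      Finset.prod_eq_one fun i hi => by rw [powDensity_zero, if_pos (hx i hi)]
    have h2 : ∀ b : ι → ℕ, ∏ i ∈ s, powDensity (b i) (x i) =
        ENNReal.ofReal (∏ i ∈ s, x i ^ b i / (b i) !) := by
      intro b
      rw [ENNReal.ofReal_prod_of_nonneg]
      · exact Finset.prod_congr rfl fun i hi => powDensity_of_nonneg _ (hx i hi)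
      · intro i hi
        have := hx i hi
        positivity
    rw [h1, mul_one, Finset.sum_congr rfl fun b _ => h2 b, powDensity_of_nonneg _ (Finset.sum_nonneg hx), ← ENNReal.ofReal_sum_of_nonneg]
    · congr 1
      rw [Finset.sum_pow_eq_sum_piAntidiag, Finset.sum_div]
      refine Finset.sum_congr rfl fun b hb => ?_
      have h3 := Nat.multinomial_spec s b
      rw [(Finset.mem_piAntidiag.1 hb).1] at h3
      have h4 : (c ! : ℝ) = (∏ i ∈ s, ((b i)! : ℝ)) * (Nat.multinomial s b : ℝ) := by
        rw [← h3]; push_cast; rfl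
      have h5 : (∏ i ∈ s, ((b i)! : ℝ)) ≠ 0 :=
        Finset.prod_ne_zero_iff.2 fun i _ => by positivity
      have h6 : (Nat.multinomial s b : ℝ) ≠ 0 := by
        intro h
        rw [h, mul_zero] at h4
        exact (Nat.cast_ne_zero.2 (Nat.factorial_ne_zero c)) h4
      rw [Finset.prod_div_distrib, h4]
      field_simp
    · intro b _
      exact Finset.prod_nonneg fun i hi => by
        have := hx i hi
        positivity
  · push Not at hx
    obtain ⟨i, hi, hxi⟩ := hx
    rw [Finset.prod_eq_zero hi (powDensity_of_neg _ hxi), mul_zero]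
    exact (Finset.sum_eq_zero fun b _ => Finset.prod_eq_zero hi (powDensity_of_neg _ hxi)).symm

/-- The integrand is the density of the Gamma distribution with shape `a + 1` and rate 1. -/
lemma lintegral_exp_mul_powDensity (a : ℕ) :
    ∫⁻ x, ENNReal.ofReal (Real.exp (-x)) * powDensity a x = 1 := by
  rw [← ProbabilityTheory.lintegral_gammaPDF_eq_one (a := a + 1) (r := 1) (by positivity) one_pos]
  refine lintegral_congr fun x => ?_
  rcases le_or_gt 0 x with hx | hx
  · rw [powDensity_of_nonneg _ hx, ProbabilityTheory.gammaPDF_of_nonneg hx,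
      ← ENNReal.ofReal_mul (Real.exp_nonneg _)]
    congr 1
    rw [Real.Gamma_nat_eq_factorial, add_sub_cancel_right, Real.rpow_natCast, Real.one_rpow,
      one_mul]
    ring
  · rw [powDensity_of_neg _ hx, ProbabilityTheory.gammaPDF_of_neg hx, mul_zero]

lemma powDensity_mul_powDensity (a b : ℕ) (x : ℝ) :
    powDensity a x * powDensity b x = (a + b).choose a * powDensity (a + b) x := by
  rcases le_or_gt 0 x with hx | hx
  · rw [powDensity_of_nonneg _ hx, powDensity_of_nonneg _ hx, powDensity_of_nonneg _ hx,
      ← ENNReal.ofReal_mul (by positivity), ← ENNReal.ofReal_natCast,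
      ← ENNReal.ofReal_mul (by positivity)]
    congr 1
    rw [Nat.choose_symm_add, Nat.add_choose, Nat.cast_div (Nat.factorial_mul_factorial_dvd_factorial_add a b)
      (by positivity)]
    push_cast
    have : ((a + b)! : ℝ) ≠ 0 := by positivity
    field_simp
    exact (pow_add x a b).symm
  · simp [powDensity_of_neg _ hx]

lemma lintegral_exp_mul_powDensity_mul (a b : ℕ) :
    ∫⁻ x, ENNReal.ofReal (Real.exp (-x)) * (powDensity a x * powDensity b x) =
      (a + b).choose a := by
  simp_rw [powDensity_mul_powDensity, mul_left_comm _ (((a + b).choose a : ℕ) : ℝ≥0∞)]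
  rw [lintegral_const_mul _ (by fun_prop), lintegral_exp_mul_powDensity, mul_one]

/-- Tonelli's theorem for a product of functions of one variable. -/
lemma lmarginal_prod {ι : Type*} [DecidableEq ι] (s : Finset ι) {g : ι → ℝ → ℝ≥0∞}
    (hg : ∀ i, Measurable (g i)) (y₀ : ι → ℝ) :
    lmarginal (fun _ : ι => (volume : Measure ℝ)) s (fun y => ∏ i ∈ s, g i (y i)) y₀ =
      ∏ i ∈ s, ∫⁻ x, g i x := by
  induction s using Finset.induction_on generalizing y₀ with
  | empty => simp
  | insert i s hi ih =>
    rw [lmarginal_insert' _ (by fun_prop) hi, Finset.prod_insert hi, ← ih y₀]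
    have h1 : ∀ y : ι → ℝ, ∫⁻ x, ∏ j ∈ insert i s, g j (Function.update y i x j) =
        (∫⁻ x, g i x) * ∏ j ∈ s, g j (y j) := by
      intro y
      rw [← lintegral_mul_const _ (hg i)]
      refine lintegral_congr fun x => ?_
      rw [Finset.prod_insert hi, Function.update_self]
      congr 1
      refine Finset.prod_congr rfl fun j hj => ?_
      rw [Function.update_of_ne (ne_of_mem_of_not_mem hj hi)]
    simp_rw [h1, lmarginal]
    rw [lintegral_const_mul _ ?_]
    have : Measurable fun y : ι → ℝ => ∏ j ∈ s, g j (y j) := by fun_prop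
    exact this.comp measurable_updateFinset

end PowerDensity

end

/-! ### Eliminating the free edges vertex by vertex. -/

noncomputable section

open MeasureTheory

namespace SignedGraph

variable {n : ℕ} {E : Type*} [Fintype E] {G : SignedGraph n E} {t : Fin (n + 1) → E}

/-- Extension of a vector on the free edges to a conserved flow. -/
def solve (hloop : G.Loopless) (ht : G.IsParentChoice t) : (E → ℝ) →ₗ[ℝ] E → ℝ where
  toFun y := (exists_isConserved hloop ht y).choose
  map_add' y z := by
    have hy := (exists_isConserved hloop ht y).choose_spec
    have hz := (exists_isConserved hloop ht z).choose_spec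
    have hyz := (exists_isConserved hloop ht (y + z)).choose_spec
    refine hyz.2.ext hloop ht (fun v hv => ?_) fun e he => ?_
    · simp only [Pi.add_apply, Finset.sum_add_distrib]
      rw [hy.2 v hv, hz.2 v hv]
    · rw [hyz.1 e he, Pi.add_apply, Pi.add_apply, hy.1 e he, hz.1 e he]
  map_smul' c y := by
    have hy := (exists_isConserved hloop ht y).choose_spec
    have hcy := (exists_isConserved hloop ht (c • y)).choose_spec
    refine hcy.2.ext hloop ht (fun v hv => ?_) fun e he => ?_
    · simp only [Pi.smul_apply, RingHom.id_apply, ← Finset.smul_sum]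
      rw [hy.2 v hv]
    · rw [hcy.1 e he]
      simp only [Pi.smul_apply, RingHom.id_apply]
      rw [hy.1 e he]

variable {hloop : G.Loopless} {ht : G.IsParentChoice t}

lemma solve_of_mem (y : E → ℝ) {e : E} (he : e ∈ G.freeEdges t) : solve hloop ht y e = y e :=
  (exists_isConserved hloop ht y).choose_spec.1 e he

lemma isConserved_solve (y : E → ℝ) : G.IsConserved (solve hloop ht y) :=
  (exists_isConserved hloop ht y).choose_spec.2

@[fun_prop]
lemma measurable_solve : Measurable (solve hloop ht) :=
  (LinearMap.continuous_of_finiteDimensional _).measurable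

lemma measurable_solve_apply (e : E) : Measurable fun y => solve hloop ht y e :=
  (measurable_pi_apply e).comp measurable_solve

/-- An integer flow on the half-edges, zero at the first vertex and beyond `k`, with the
conservation law `∑ (b + 1) = ∑ b + 1` at the vertices up to `k`. -/
def IsPartialFlow (G : SignedGraph n E) (k : ℕ) (b : G.HalfEdge → ℕ) : Prop :=
  (∀ h, G.vertex h = 0 ∨ k < (G.vertex h : ℕ) → b h = 0) ∧
    ∀ v : Fin (n + 1), v ≠ 0 → (v : ℕ) ≤ k →
      ∑ e ∈ G.inEdges v, (b (Sum.inl e) + 1) = ∑ h ∈ G.outHalves v, b h + 1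

/-- The half-edges of the edges that are positive or enter a vertex beyond `k`. -/
def laterHalves (G : SignedGraph n E) (k : ℕ) : Finset G.HalfEdge :=
  Finset.univ.filter fun h => G.sign (G.edge h) = 1 ∨ k < (G.tgt (G.edge h) : ℕ)

@[simp] lemma mem_laterHalves {k : ℕ} {h : G.HalfEdge} :
    h ∈ G.laterHalves k ↔ G.sign (G.edge h) = 1 ∨ k < (G.tgt (G.edge h) : ℕ) := by
  simp [laterHalves]

variable (hloop ht) in
/-- The integrand obtained after eliminating the edges entering the vertices up to `k`. -/
def flowDensity (k : ℕ) (b : G.HalfEdge → ℕ) (y : E → ℝ) : ℝ≥0∞ :=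
  (∏ e ∈ G.posEdges, ENNReal.ofReal (Real.exp (-y e))) *
    ∏ h ∈ G.laterHalves k, powDensity (b h) (solve hloop ht y (G.edge h))

lemma measurable_flowDensity (k : ℕ) (b : G.HalfEdge → ℕ) :
    Measurable (flowDensity hloop ht k b) := by
  unfold flowDensity
  refine Measurable.mul (by fun_prop) (Finset.measurable_prod _ fun h _ => ?_)
  exact (measurable_powDensity _).comp (measurable_solve_apply _)

lemma disjoint_laterHalves {k : ℕ} {v : Fin (n + 1)} (hv : (v : ℕ) = k + 1) :
    Disjoint ((G.inEdges v).map Function.Embedding.inl) (G.laterHalves (k + 1)) := by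
  rw [Finset.disjoint_left]
  intro h h1 h2
  obtain ⟨e, he, rfl⟩ := Finset.mem_map.1 h1
  rw [mem_inEdges] at he
  rw [mem_laterHalves] at h2
  simp only [edge, Function.Embedding.inl_apply, Sum.elim_inl, id, he.2, hv] at h2
  rcases h2 with h2 | h2
  · exact sign_eq_neg_one_iff.1 he.1 h2
  · omega

lemma Loopless.outHalves_subset (hloop : G.Loopless) (v : Fin (n + 1)) :
    G.outHalves v ⊆ G.laterHalves v := by
  intro h hh
  rw [mem_laterHalves]
  exact hloop.pos_or_lt (mem_outHalves.1 hh)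

/-- The free negative edges entering a vertex up to `k`. -/
def earlyEdges (G : SignedGraph n E) (t : Fin (n + 1) → E) (k : ℕ) : Finset E :=
  (G.freeEdges t).filter fun e => G.sign e = -1 ∧ (G.tgt e : ℕ) ≤ k

@[simp] lemma mem_earlyEdges {k : ℕ} {e : E} :
    e ∈ G.earlyEdges t k ↔ e ∈ G.freeEdges t ∧ G.sign e = -1 ∧ (G.tgt e : ℕ) ≤ k := by
  simp only [earlyEdges, Finset.mem_filter]

lemma isPartialFlow_zero {b : G.HalfEdge → ℕ} :
    G.IsPartialFlow 0 b ↔ b = 0 := by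
  constructor
  · intro h
    funext x
    refine h.1 x ?_
    by_cases hx : G.vertex x = 0
    · exact Or.inl hx
    · exact Or.inr (Nat.pos_of_ne_zero fun h' => hx (Fin.ext h'))
  · rintro rfl
    exact ⟨fun _ _ => rfl, fun v hv hv0 => absurd (Fin.ext (Nat.le_zero.1 hv0)) hv⟩

lemma vertex_inl_lt (hloop : G.Loopless) {v : Fin (n + 1)} {e : E} (he : e ∈ G.inEdges v) :
    G.vertex (Sum.inl e) < v := by
  rw [← (mem_inEdges.1 he).2]
  exact hloop.src_lt_tgt e

/-- Exponent 0 turns every factor into the indicator of nonnegativity, so the starting integrand is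
the exponential weight on the cone. -/
lemma flowDensity_zero (y : E → ℝ) : flowDensity hloop ht 0 0 y =
    if ∀ e, 0 ≤ solve hloop ht y e then
      ENNReal.ofReal (Real.exp (-∑ e ∈ G.posEdges, y e)) else 0 := by
  have h1 : ∏ e ∈ G.posEdges, ENNReal.ofReal (Real.exp (-y e)) =
      ENNReal.ofReal (Real.exp (-∑ e ∈ G.posEdges, y e)) := by
    rw [← ENNReal.ofReal_prod_of_nonneg fun _ _ => Real.exp_nonneg _, ← Real.exp_sum,
      Finset.sum_neg_distrib]
  rw [flowDensity, h1]
  split_ifs with h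
  · rw [Finset.prod_eq_one, mul_one]
    intro x _
    rw [Pi.zero_apply, powDensity_zero, if_pos (h _)]
  · push Not at h
    obtain ⟨e, he⟩ := h
    rw [Finset.prod_eq_zero (i := Sum.inl e) ?_ (powDensity_of_neg _ he), mul_zero]
    rw [mem_laterHalves]
    right
    have : (G.src e : ℕ) < G.tgt e := hloop.src_lt_tgt e
    change 0 < (G.tgt e : ℕ)
    omega

/-- No target lies beyond `n`, so only positive edges remain. These are free, hence the integrand is
a product of functions of one variable. -/
lemma flowDensity_last (b : G.HalfEdge → ℕ) (y : E → ℝ) :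
    flowDensity hloop ht n b y = ∏ e ∈ G.posEdges,
      (if h : G.sign e = 1 then fun x => ENNReal.ofReal (Real.exp (-x)) *
        (powDensity (b (Sum.inl e)) x * powDensity (b (Sum.inr ⟨e, h⟩)) x) else fun _ => 1) (y e) := by
  have h1 : ∏ h ∈ G.laterHalves n, powDensity (b h) (solve hloop ht y (G.edge h)) =
      ∏ e : {e : E // G.sign e = 1},
        powDensity (b (Sum.inl e.1)) (y e) * powDensity (b (Sum.inr e)) (y e) := by
    rw [laterHalves, Finset.prod_filter, Fintype.prod_sum_type, Finset.prod_mul_distrib]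
    congr 1
    · rw [← Finset.prod_filter, Finset.prod_subtype (p := fun e => G.sign e = 1)]
      · refine Finset.prod_congr rfl fun e _ => ?_
        rw [edge, Sum.elim_inl, id, solve_of_mem _ (ht.mem_freeEdges_of_pos e.2)]
      · intro e
        have := (G.tgt e).2
        rw [Finset.mem_filter, and_iff_right (Finset.mem_univ _)]
        change G.sign e = 1 ∨ n < (G.tgt e : ℕ) ↔ _
        exact or_iff_left (by omega)
    · refine Finset.prod_congr rfl fun e _ => ?_
      rw [if_pos (show G.sign (G.edge (Sum.inr e)) = 1 ∨ _ from Or.inl e.2), edge, Sum.elim_inr, solve_of_mem _ (ht.mem_freeEdges_of_pos e.2)]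
  rw [flowDensity, h1, Finset.prod_subtype _ (fun e => mem_posEdges (G := G) (e := e)),
    Finset.prod_subtype _ (fun e => mem_posEdges (G := G) (e := e)), ← Finset.prod_mul_distrib]
  refine Finset.prod_congr rfl fun e _ => ?_
  rw [dif_pos e.2]

variable [DecidableEq E]

lemma laterHalves_eq_union {k : ℕ} {v : Fin (n + 1)} (hv : (v : ℕ) = k + 1) :
    G.laterHalves k = (G.inEdges v).map Function.Embedding.inl ∪ G.laterHalves (k + 1) := by
  ext h
  simp only [mem_laterHalves, Finset.mem_union, Finset.mem_map, mem_inEdges,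
    Function.Embedding.inl_apply]
  rcases h with e | e
  · simp only [edge, Sum.elim_inl, id, Sum.inl.injEq, exists_eq_right, Fin.ext_iff, hv]
    rw [sign_eq_neg_one_iff]
    by_cases h1 : G.sign e = 1
    · simp [h1]
    · simp only [ne_eq, h1, false_or, not_false_eq_true, true_and]
      constructor
      · intro h2; omega
      · intro h2; omega
  · simp [edge, e.2]

/-- Eliminating the edges entering one vertex. -/
lemma lmarginal_flowDensity {k : ℕ} {v : Fin (n + 1)} (hv : (v : ℕ) = k + 1)
    (b : G.HalfEdge → ℕ) (hb : ∀ h ∈ G.outHalves v, b h = 0) (y : E → ℝ) :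
    lmarginal (fun _ : E => (volume : Measure ℝ)) ((G.inEdges v).erase (t v))
      (flowDensity hloop ht k b) y =
    ∑ b' ∈ (G.outHalves v).piAntidiag (∑ e ∈ G.inEdges v, (b (Sum.inl e) + 1) - 1),
      flowDensity hloop ht (k + 1) (b + b') y := by
  have hv0 : v ≠ 0 := fun h => by rw [h, Fin.val_zero] at hv; omega
  set s := (G.inEdges v).erase (t v) with hs
  set X := ∑ h ∈ G.outHalves v, solve hloop ht y (G.edge h) with hX
  set A := ∏ e ∈ G.posEdges, ENNReal.ofReal (Real.exp (-y e)) with hA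
  set C := ∏ h ∈ G.laterHalves (k + 1), powDensity (b h) (solve hloop ht y (G.edge h)) with hC
  have hsub : G.outHalves v ⊆ G.laterHalves (k + 1) := hv ▸ hloop.outHalves_subset v
  -- Moving the free edges into `v` changes no positive edge and no edge with a later target. Among
  -- the factors only those of edges into `v` vary, and the parent carries the rest of the outflow
  -- `X`.
  have key : ∀ z : s → ℝ, flowDensity hloop ht k b (Function.updateFinset y s z) =
      A * C * (fun y' : E → ℝ => (∏ e ∈ s, powDensity (b (Sum.inl e)) (y' e)) *
        powDensity (b (Sum.inl (t v))) (X - ∑ e ∈ s, y' e)) (Function.updateFinset y s z) := by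
    intro z
    set y' := Function.updateFinset y s z with hy'
    have hne : ∀ e ∉ s, y' e = y e := fun e he => by simp [hy', Function.updateFinset, he]
    have hsneg : ∀ e ∈ s, G.sign e = -1 ∧ G.tgt e = v := fun e he =>
      mem_inEdges.1 (Finset.mem_of_mem_erase he)
    have h1 : ∀ h ∈ G.laterHalves (k + 1),
        solve hloop ht y' (G.edge h) = solve hloop ht y (G.edge h) := by
      intro h hh
      refine (isConserved_solve y').eq_of_eq hloop ht (isConserved_solve y) (k + 1)
        (fun e he hek => ?_) (mem_laterHalves.1 hh)
      rw [solve_of_mem _ he, solve_of_mem _ he, hne]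
      intro hes
      obtain ⟨h2, h3⟩ := hsneg e hes
      rcases hek with h4 | h4
      · exact sign_eq_neg_one_iff.1 h2 h4
      · rw [h3] at h4; omega
    have h2 : ∏ e ∈ G.posEdges, ENNReal.ofReal (Real.exp (-y' e)) = A := by
      refine Finset.prod_congr rfl fun e he => ?_
      rw [hne e fun hes => sign_eq_neg_one_iff.1 (hsneg e hes).1 (mem_posEdges.1 he)]
    have h3 : ∀ e ∈ s, solve hloop ht y' e = y' e := fun e he =>
      solve_of_mem _ (ht.mem_freeEdges_of_mem (Finset.mem_of_mem_erase he)
        (Finset.ne_of_mem_erase he))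
    have h4 : solve hloop ht y' (t v) = X - ∑ e ∈ s, y' e := by
      have h5 := isConserved_solve (hloop := hloop) (ht := ht) y' v hv0
      rw [← Finset.add_sum_erase _ _ (ht v hv0), ← hs, Finset.sum_congr rfl h3,
        Finset.sum_congr rfl fun h hh => h1 h (hsub hh)] at h5
      exact eq_sub_of_add_eq h5
    unfold flowDensity
    rw [h2, laterHalves_eq_union hv, Finset.prod_union (disjoint_laterHalves hv), Finset.prod_map,
      ← Finset.mul_prod_erase _ _ (ht v hv0), ← hs]
    rw [Finset.prod_congr (g := fun h => powDensity (b h) (solve hloop ht y (G.edge h)))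
      (rfl : G.laterHalves (k + 1) = _) (fun h hh => by rw [h1 h hh]), ← hC]
    simp only [Function.Embedding.inl_apply, edge, Sum.elim_inl, id]
    rw [h4, Finset.prod_congr (g := fun e => powDensity (b (Sum.inl e)) (y' e)) (rfl : s = _)
      (fun e he => by rw [h3 e he])]
    ring
  -- The parent edge is not integrated over and contributes only its exponent, whence the `- 1`.
  have hcount : b (Sum.inl (t v)) + ∑ e ∈ s, (b (Sum.inl e) + 1) =
      ∑ e ∈ G.inEdges v, (b (Sum.inl e) + 1) - 1 := by
    rw [← Finset.add_sum_erase _ _ (ht v hv0), ← hs]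
    omega
  rw [lmarginal, lintegral_congr key, lintegral_const_mul _ ?_]
  · have h5 := lmarginal_prod_powDensity s (fun e => b (Sum.inl e)) (b (Sum.inl (t v))) X y
    rw [lmarginal] at h5
    rw [h5, hcount]
    -- By `hb` the half-edges at `v` still have exponent 0. Their factors are the nonnegativity
    -- indicators required by `powDensity_sum`.
    rw [hC, ← Finset.prod_sdiff hsub,
      Finset.prod_congr (g := fun h => powDensity 0 (solve hloop ht y (G.edge h)))
        (rfl : G.outHalves v = _) (fun h hh => by rw [hb h hh]), mul_assoc, mul_assoc,
        mul_comm _ (powDensity _ X), powDensity_sum, Finset.mul_sum, Finset.mul_sum]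
    refine Finset.sum_congr rfl fun b' hb' => ?_
    rw [flowDensity, ← Finset.prod_sdiff hsub, ← hA]
    congr 2
    · refine Finset.prod_congr rfl fun h hh => ?_
      have : b' h = 0 := by
        by_contra hne
        exact (Finset.mem_sdiff.1 hh).2 ((Finset.mem_piAntidiag.1 hb').2 h hne)
      rw [Pi.add_apply, this, add_zero]
    · refine Finset.prod_congr rfl fun h hh => ?_
      rw [Pi.add_apply, hb h hh, zero_add]
  · have : Measurable fun y' : E → ℝ => (∏ e ∈ s, powDensity (b (Sum.inl e)) (y' e)) *
        powDensity (b (Sum.inl (t v))) (X - ∑ e ∈ s, y' e) := by fun_prop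
    exact this.comp measurable_updateFinset

/-- Split `b` into its values at vertices up to `k` and at `v`. Edges into vertices up to `v` start
strictly before `v`, so the new values enter only the outgoing side of the law at `v`. -/
lemma isPartialFlow_succ (hloop : G.Loopless) (ht : G.IsParentChoice t) {k : ℕ} {v : Fin (n + 1)}
    (hv : (v : ℕ) = k + 1) {b : G.HalfEdge → ℕ} :
    G.IsPartialFlow (k + 1) b ↔ ∃ b₁ b₂, G.IsPartialFlow k b₁ ∧
      b₂ ∈ (G.outHalves v).piAntidiag (∑ e ∈ G.inEdges v, (b₁ (Sum.inl e) + 1) - 1) ∧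
      b₁ + b₂ = b := by
  have hv0 : v ≠ 0 := fun h => by rw [h, Fin.val_zero] at hv; omega
  have hlt : ∀ w : Fin (n + 1), ∀ e ∈ G.inEdges w, (G.vertex (Sum.inl e) : ℕ) < w :=
    fun w e he => vertex_inl_lt hloop he
  have hpos : ∀ b : G.HalfEdge → ℕ, 1 ≤ ∑ e ∈ G.inEdges v, (b (Sum.inl e) + 1) := fun b =>
    le_trans (by omega) (Finset.single_le_sum (f := fun e => b (Sum.inl e) + 1)
      (fun _ _ => Nat.zero_le _) (ht v hv0))
  constructor
  · rintro ⟨h1, h2⟩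
    refine ⟨fun h => if (G.vertex h : ℕ) ≤ k then b h else 0,
      fun h => if G.vertex h = v then b h else 0, ⟨?_, ?_⟩, ?_, ?_⟩
    · rintro h (hh | hh)
      · simp [hh, h1 h (Or.inl hh)]
      · simp [not_le.2 hh]
    · intro w hw hwk
      have h3 : ∀ e ∈ G.inEdges w, (if (G.vertex (Sum.inl e) : ℕ) ≤ k then b (Sum.inl e) else 0) +
          1 = b (Sum.inl e) + 1 := fun e he => by
        rw [if_pos (by have := hlt w e he; omega)]
      rw [Finset.sum_congr rfl h3, h2 w hw (by omega)]
      congr 1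
      refine Finset.sum_congr rfl fun h hh => ?_
      rw [mem_outHalves] at hh
      simp [hh, hwk]
    · rw [Finset.mem_piAntidiag]
      constructor
      · have h3 : ∀ e ∈ G.inEdges v, (if (G.vertex (Sum.inl e) : ℕ) ≤ k then b (Sum.inl e) else 0) +
            1 = b (Sum.inl e) + 1 := fun e he => by
          rw [if_pos (by have := hlt v e he; omega)]
        rw [Finset.sum_congr rfl h3, h2 v hv0 hv.le, add_tsub_cancel_right]
        refine Finset.sum_congr rfl fun h hh => ?_
        rw [if_pos (mem_outHalves.1 hh)]
      · intro h hh
        rw [mem_outHalves]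
        by_contra hne
        exact hh (if_neg hne)
    · funext h
      simp only [Pi.add_apply, Fin.ext_iff, hv]
      rcases lt_trichotomy (G.vertex h : ℕ) (k + 1) with hh | hh | hh
      · rw [if_pos (by omega), if_neg (by omega), add_zero]
      · rw [if_neg (by omega), if_pos hh, zero_add]
      · rw [if_neg (by omega), if_neg (by omega), h1 h (Or.inr hh)]
  · rintro ⟨b₁, b₂, ⟨h1, h2⟩, h3, rfl⟩
    rw [Finset.mem_piAntidiag] at h3
    have hb₂ : ∀ h, G.vertex h ≠ v → b₂ h = 0 := fun h hh => by
      by_contra hne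
      exact hh (mem_outHalves.1 (h3.2 h hne))
    have hin : ∀ w : Fin (n + 1), (w : ℕ) ≤ k + 1 → ∀ e ∈ G.inEdges w, b₂ (Sum.inl e) = 0 := by
      intro w hw e he
      refine hb₂ _ fun h => ?_
      have := hlt w e he
      rw [h, hv] at this
      omega
    refine ⟨?_, fun w hw hwk => ?_⟩
    · rintro h (hh | hh)
      · rw [Pi.add_apply, h1 h (Or.inl hh), hb₂ h (by rw [hh]; exact hv0.symm)]
      · rw [Pi.add_apply, h1 h (Or.inr (by omega)), hb₂ h (fun h' => by rw [h'] at hh; omega)]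
    · simp only [Pi.add_apply]
      rw [Finset.sum_congr (g := fun e => b₁ (Sum.inl e) + 1) (rfl : G.inEdges w = _)
          (fun e he => by rw [hin w hwk e he, add_zero]),
        Finset.sum_add_distrib (s := G.outHalves w)]
      by_cases hwv : w = v
      · subst hwv
        rw [h3.1, Finset.sum_eq_zero fun h hh => h1 h (Or.inr (by
          rw [mem_outHalves.1 hh]; omega)), zero_add, Nat.sub_add_cancel (hpos b₁)]
      · have hwk' : (w : ℕ) ≤ k := by
          have : (w : ℕ) ≠ v := fun h => hwv (Fin.ext h)
          omega
        rw [h2 w hw hwk', Finset.sum_eq_zero (f := b₂) fun h hh => hb₂ h (by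
          rw [mem_outHalves.1 hh]; exact hwv), add_zero]

lemma earlyEdges_succ (ht : G.IsParentChoice t) {k : ℕ} {v : Fin (n + 1)} (hv : (v : ℕ) = k + 1) :
    G.earlyEdges t (k + 1) = (G.inEdges v).erase (t v) ∪ G.earlyEdges t k := by
  have hv0 : v ≠ 0 := fun h => by rw [h, Fin.val_zero] at hv; omega
  ext e
  rw [Finset.mem_union, Finset.mem_erase, mem_earlyEdges, mem_earlyEdges, mem_inEdges, Fin.ext_iff,
    hv]
  constructor
  · rintro ⟨h1, h2, h3⟩
    by_cases h4 : (G.tgt e : ℕ) = k + 1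
    · exact Or.inl ⟨mem_freeEdges.1 h1 v hv0, h2, h4⟩
    · exact Or.inr ⟨h1, h2, by omega⟩
  · rintro (⟨h1, h2, h3⟩ | ⟨h1, h2, h3⟩)
    · exact ⟨ht.mem_freeEdges_of_mem (mem_inEdges.2 ⟨h2, Fin.ext (h3.trans hv.symm)⟩) h1, h2, h3.le⟩
    · exact ⟨h1, h2, by omega⟩

/-- Eliminating the edges entering the vertices up to `k`. -/
lemma exists_lmarginal_earlyEdges (k : ℕ) (hk : k ≤ n) :
    ∃ B : Finset (G.HalfEdge → ℕ), (∀ b, b ∈ B ↔ G.IsPartialFlow k b) ∧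
      lmarginal (fun _ : E => (volume : Measure ℝ)) (G.earlyEdges t k)
        (flowDensity hloop ht 0 0) = fun y => ∑ b ∈ B, flowDensity hloop ht k b y := by
  induction k with
  | zero =>
    refine ⟨{0}, fun b => by rw [Finset.mem_singleton, isPartialFlow_zero], ?_⟩
    have : G.earlyEdges t 0 = ∅ := by
      ext e
      have : (G.src e : ℕ) < G.tgt e := hloop.src_lt_tgt e
      simp only [mem_earlyEdges, Finset.notMem_empty, iff_false]
      omega
    rw [this, lmarginal_empty]
    simp
  | succ k ih =>
    obtain ⟨B, hB, hBk⟩ := ih (by omega)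
    let v : Fin (n + 1) := ⟨k + 1, by omega⟩
    have hv : (v : ℕ) = k + 1 := rfl
    let S := B.sigma fun b =>
      (G.outHalves v).piAntidiag (∑ e ∈ G.inEdges v, (b (Sum.inl e) + 1) - 1)
    refine ⟨S.image fun p => p.1 + p.2, fun b => ?_, ?_⟩
    · rw [isPartialFlow_succ hloop ht hv, Finset.mem_image]
      constructor
      · rintro ⟨⟨b₁, b₂⟩, h, rfl⟩
        rw [Finset.mem_sigma] at h
        exact ⟨b₁, b₂, (hB _).1 h.1, h.2, rfl⟩
      · rintro ⟨b₁, b₂, h1, h2, rfl⟩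
        exact ⟨⟨b₁, b₂⟩, Finset.mem_sigma.2 ⟨(hB _).2 h1, h2⟩, rfl⟩
    · have hdisj : Disjoint ((G.inEdges v).erase (t v)) (G.earlyEdges t k) := by
        rw [Finset.disjoint_left]
        intro e h1 h2
        have h3 := (mem_inEdges.1 (Finset.mem_of_mem_erase h1)).2
        have h4 := (mem_earlyEdges.1 h2).2.2
        rw [h3] at h4
        omega
      rw [earlyEdges_succ ht hv, lmarginal_union _ _ (measurable_flowDensity _ _) hdisj, hBk]
      funext y
      have hb0 : ∀ b ∈ B, ∀ h ∈ G.outHalves v, b h = 0 := fun b hb h hh =>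
        ((hB b).1 hb).1 h (Or.inr (by rw [mem_outHalves.1 hh]; omega))
      -- No flow is counted twice: `b₁` vanishes on the half-edges at `v` and `b₂` is supported
      -- there, so the sum determines both.
      rw [Finset.sum_image, Finset.sum_sigma]
      · rw [lmarginal, lintegral_finsetSum]
        · exact Finset.sum_congr rfl fun b hb => lmarginal_flowDensity hv b (hb0 b hb) y
        · exact fun b _ => (measurable_flowDensity _ _).comp measurable_updateFinset
      · rintro ⟨b₁, b₂⟩ h ⟨b₁', b₂'⟩ h' heq
        rw [Finset.mem_coe, Finset.mem_sigma] at h h'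
        obtain ⟨h1, h2⟩ := h
        obtain ⟨h1', h2'⟩ := h'
        simp only at h1 h2 h1' h2' heq
        have e1 : b₁ = b₁' := by
          funext x
          by_cases hx : x ∈ G.outHalves v
          · rw [hb0 _ h1 x hx, hb0 _ h1' x hx]
          · have h3 : b₂ x = 0 := by
              by_contra hne
              exact hx ((Finset.mem_piAntidiag.1 h2).2 x hne)
            have h4 : b₂' x = 0 := by
              by_contra hne
              exact hx ((Finset.mem_piAntidiag.1 h2').2 x hne)
            have := congrFun heq x
            simpa [h3, h4] using this
        subst e1
        rw [add_left_cancel heq]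

lemma freeEdges_eq_union (ht : G.IsParentChoice t) :
    G.freeEdges t = G.posEdges ∪ G.earlyEdges t n := by
  ext e
  rw [Finset.mem_union, mem_posEdges, mem_earlyEdges]
  constructor
  · intro h
    by_cases h1 : G.sign e = 1
    · exact Or.inl h1
    · exact Or.inr ⟨h, sign_eq_neg_one_iff.2 h1, by omega⟩
  · rintro (h | h)
    · exact ht.mem_freeEdges_of_pos h
    · exact h.1

/-- The integral over the free edges as a sum over integer flows. -/
lemma exists_lmarginal_freeEdges :
    ∃ B : Finset (G.HalfEdge → ℕ), (∀ b, b ∈ B ↔ G.IsPartialFlow n b) ∧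
      ∀ y, lmarginal (fun _ : E => (volume : Measure ℝ)) (G.freeEdges t)
        (flowDensity hloop ht 0 0) y = ∑ b ∈ B, ∏ e : {e : E // G.sign e = 1},
          (((b (Sum.inl e.1) + b (Sum.inr e)).choose (b (Sum.inl e.1)) : ℕ) : ℝ≥0∞) := by
  obtain ⟨B, hB, hBn⟩ := exists_lmarginal_earlyEdges (hloop := hloop) (ht := ht) n le_rfl
  refine ⟨B, hB, fun y => ?_⟩
  have hdisj : Disjoint G.posEdges (G.earlyEdges t n) := by
    rw [Finset.disjoint_left]
    intro e h1 h2
    exact sign_eq_neg_one_iff.1 (mem_earlyEdges.1 h2).2.1 (mem_posEdges.1 h1)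
  rw [freeEdges_eq_union ht, lmarginal_union _ _ (measurable_flowDensity _ _) hdisj, hBn,
    lmarginal, lintegral_finsetSum]
  swap
  · exact fun b _ => (measurable_flowDensity _ _).comp measurable_updateFinset
  refine Finset.sum_congr rfl fun b _ => ?_
  simp_rw [flowDensity_last]
  have hg : ∀ e, Measurable (if h : G.sign e = 1 then fun x => ENNReal.ofReal (Real.exp (-x)) *
        (powDensity (b (Sum.inl e)) x * powDensity (b (Sum.inr ⟨e, h⟩)) x) else fun _ => 1) := by
    intro e
    split_ifs <;> fun_prop
  have := lmarginal_prod G.posEdges hg y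
  rw [lmarginal] at this
  rw [this, Finset.prod_subtype _ (fun e => mem_posEdges (G := G) (e := e))]
  refine Finset.prod_congr rfl fun e _ => ?_
  rw [dif_pos e.2, lintegral_exp_mul_powDensity_mul]

end SignedGraph

end

/-! ### Counting dynamic flows. -/

noncomputable section

namespace SignedGraph

variable {n : ℕ} {E : Type*} [Fintype E] {G : SignedGraph n E}

/-- Stars and bars. -/
lemma card_sum_eq (l r : ℕ) :
    Nat.card {g : Fin (l + 1) → ℕ // ∑ k, g k = r} = (l + r).choose l := by
  rw [← Nat.card_congr (Sym.equivNatSumOfFintype (Fin (l + 1)) r), Nat.card_eq_fintype_card,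
    Sym.card_sym_eq_multichoose, Fintype.card_fin, Nat.multichoose_eq,
    show l + 1 + r - 1 = l + r by omega, Nat.choose_symm_add]

lemma sum_neg_add_sum_pos (f : E → ℕ) :
    ∑ e : {e : E // G.sign e = -1}, f e + ∑ e : {e : E // G.sign e = 1}, f e = ∑ e, f e := by
  rw [sum_negSubtype, sum_posSubtype, ← Finset.sum_add_distrib]
  refine Finset.sum_congr rfl fun e _ => ?_
  rcases Int.units_eq_one_or (G.sign e) with h | h <;> simp [h]

/-- The conservation law of dynamic flows in terms of the totals `br` on the right halves. -/
lemma isPartialFlow_elim_iff (hloop : G.Loopless) (bl : E → ℕ)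
    (br : {e : E // G.sign e = 1} → ℕ) :
    G.IsPartialFlow n (Sum.elim bl br) ↔ ∀ v : Fin (n + 1),
      ((∑ e : {e : E // G.sign e = -1}, if G.tgt e = v then bl e else 0 : ℕ) : ℤ) +
        G.shiftedIndeg v =
      ((∑ e : {e : E // G.sign e = -1}, if G.src e = v then bl e else 0 : ℕ) : ℤ)
      + ((∑ e : {e : E // G.sign e = 1}, if G.src e = v then bl e else 0 : ℕ) : ℤ)
      + ((∑ e : {e : E // G.sign e = 1}, if G.tgt e = v then br e else 0 : ℕ) : ℤ) := by
  have hin : ∀ v, ∑ e : {e : E // G.sign e = -1}, (if G.tgt e = v then bl e else 0) =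
      ∑ e ∈ G.inEdges v, bl e := by
    intro v
    rw [sum_negSubtype (fun e => if G.tgt e = v then bl e else 0), sum_inEdges]
    exact Finset.sum_congr rfl fun e _ => (ite_and _ _ _ _).symm
  have hout : ∀ v, ((∑ e : {e : E // G.sign e = -1}, if G.src e = v then bl e else 0 : ℕ) : ℤ)
      + ((∑ e : {e : E // G.sign e = 1}, if G.src e = v then bl e else 0 : ℕ) : ℤ)
      + ((∑ e : {e : E // G.sign e = 1}, if G.tgt e = v then br e else 0 : ℕ) : ℤ) =
      ((∑ h ∈ G.outHalves v, Sum.elim bl br h : ℕ) : ℤ) := by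
    intro v
    rw [sum_outHalves, ← sum_neg_add_sum_pos (G := G)]
    push_cast
    rfl
  simp_rw [hin, hout]
  constructor
  · rintro ⟨h1, h2⟩ v
    by_cases hv : v = 0
    · have h3 : G.inEdges v = ∅ := Finset.eq_empty_of_forall_notMem fun e he => by
        have := vertex_inl_lt hloop he
        rw [hv] at this
        exact absurd this (Fin.not_lt_zero _)
      have h4 : ∑ h ∈ G.outHalves v, Sum.elim bl br h = 0 :=
        Finset.sum_eq_zero fun h hh => h1 h (Or.inl ((mem_outHalves.1 hh).trans hv))
      rw [h3, h4]
      simp [shiftedIndeg, hv]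
    · have h3 := h2 v hv (by omega)
      rw [Finset.sum_add_distrib, Finset.sum_const, card_inEdges] at h3
      simp only [Sum.elim_inl, smul_eq_mul, mul_one] at h3
      rw [shiftedIndeg, if_neg hv]
      omega
  · intro h
    refine ⟨fun x hx => ?_, fun v hv _ => ?_⟩
    · have hx : G.vertex x = 0 := hx.resolve_right (by omega)
      have h1 := h 0
      have h3 : G.inEdges 0 = ∅ := Finset.eq_empty_of_forall_notMem fun e he =>
        absurd (vertex_inl_lt hloop he) (Fin.not_lt_zero _)
      rw [h3, shiftedIndeg, if_pos rfl, Finset.sum_empty, Nat.cast_zero, zero_add, eq_comm,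
        Nat.cast_eq_zero, Finset.sum_eq_zero_iff] at h1
      exact h1 x (mem_outHalves.2 hx)
    · have h1 := h v
      rw [shiftedIndeg, if_neg hv] at h1
      rw [Finset.sum_add_distrib, Finset.sum_const, card_inEdges]
      simp only [Sum.elim_inl, smul_eq_mul, mul_one]
      omega

/-- The integer flow on the half-edges and the distribution of the flow on the right halves over the
extra half-edges determine a dynamic flow. -/
def toDynamicFlow (hloop : G.Loopless) (B : Finset (G.HalfEdge → ℕ))
    (hB : ∀ b, b ∈ B ↔ G.IsPartialFlow n b)
    (x : Σ b : B, (e : {e : E // G.sign e = 1}) →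
      {g : Fin (b.1 (Sum.inl e.1) + 1) → ℕ // ∑ k, g k = b.1 (Sum.inr e)}) :
    G.DynamicFlow G.shiftedIndeg where
  flow e := x.1.1 (Sum.inl e.1)
  left e := x.1.1 (Sum.inl e.1)
  right e := (x.2 e).1 0
  extra e k := (x.2 e).1 k.succ
  conservation v := by
    have h1 := (isPartialFlow_elim_iff hloop (fun e => x.1.1 (Sum.inl e))
      (fun e => x.1.1 (Sum.inr e))).1
      (by
        have := (hB x.1.1).1 x.1.2
        convert this using 1
        funext h
        rcases h with h | h <;> rfl) v
    have h2 : ∑ e : {e : E // G.sign e = 1}, (if G.tgt e = v then x.1.1 (Sum.inr e) else 0) =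
        (∑ e : {e : E // G.sign e = 1}, if G.tgt e = v then (x.2 e).1 0 else 0) +
        ∑ e : {e : E // G.sign e = 1}, if G.tgt e = v then ∑ k, (x.2 e).1 (Fin.succ k) else 0 := by
      rw [← Finset.sum_add_distrib]
      refine Finset.sum_congr rfl fun e _ => ?_
      split_ifs
      · exact (x.2 e).2.symm.trans (Fin.sum_univ_succ _)
      · rfl
    rw [h1, h2, Nat.cast_add]
    ring

lemma toDynamicFlow_bijective (hloop : G.Loopless) (B : Finset (G.HalfEdge → ℕ))
    (hB : ∀ b, b ∈ B ↔ G.IsPartialFlow n b) :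
    Function.Bijective (toDynamicFlow hloop B hB) := by
  constructor
  · rintro ⟨⟨b, hb⟩, g⟩ ⟨⟨b', hb'⟩, g'⟩ h
    obtain ⟨bl, br, rfl⟩ : ∃ bl br, b = Sum.elim bl br :=
      ⟨_, _, (Sum.elim_comp_inl_inr b).symm⟩
    obtain ⟨bl', br', rfl⟩ : ∃ bl br, b' = Sum.elim bl br :=
      ⟨_, _, (Sum.elim_comp_inl_inr b').symm⟩
    simp only [toDynamicFlow, Sum.elim_inl, DynamicFlow.mk.injEq] at h
    obtain ⟨h1, h2, h3, h4⟩ := h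
    obtain rfl : bl = bl' := by
      funext e
      rcases Int.units_eq_one_or (G.sign e) with h | h
      · exact congrFun h2 ⟨e, h⟩
      · exact congrFun h1 ⟨e, h⟩
    have h5 := eq_of_heq h4
    have h6 : ∀ e, (g e).1 = (g' e).1 := by
      intro e
      funext k
      refine Fin.cases ?_ (fun k => ?_) k
      · exact congrFun h3 e
      · exact congrFun (congrFun h5 e) k
    obtain rfl : br = br' := by
      funext e
      have h7 := (g e).2
      rw [h6 e] at h7
      exact h7.symm.trans (g' e).2
    obtain rfl : g = g' := funext fun e => Subtype.ext (h6 e)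
    rfl
  · rintro ⟨flow, left, right, extra, hcons⟩
    classical
    -- Every edge is negative or positive, so `flow` and `left` glue to one function of the edges,
    -- the exponents on left halves.
    obtain ⟨bl, rfl, rfl⟩ : ∃ bl : E → ℕ, flow = (fun e => bl e.1) ∧ left = fun e => bl e.1 := by
      refine ⟨fun e => if h : G.sign e = 1 then left ⟨e, h⟩ else
        flow ⟨e, sign_eq_neg_one_iff.2 h⟩, ?_, ?_⟩
      · funext e
        dsimp only
        rw [dif_neg (sign_eq_neg_one_iff.1 e.2)]
      · funext e
        dsimp only
        rw [dif_pos e.2]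
    have hb : G.IsPartialFlow n (Sum.elim bl fun e => ∑ k : Fin (bl e.1 + 1),
        (Fin.cons (right e) (extra e) : Fin (bl e.1 + 1) → ℕ) k) := by
      rw [isPartialFlow_elim_iff hloop]
      intro v
      refine (hcons v).trans ?_
      rw [add_assoc, ← Nat.cast_add (∑ e : {e : E // G.sign e = 1}, if G.tgt e = v then right e else 0),
        ← Finset.sum_add_distrib]
      congr 2
      refine Finset.sum_congr rfl fun e _ => ?_
      split_ifs
      · rw [Fin.sum_univ_succ]
        rfl
      · rfl
    exact ⟨⟨⟨_, (hB _).2 hb⟩, fun e => ⟨Fin.cons (right e) (extra e), rfl⟩⟩, rfl⟩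

/-- The fibre over `b` is a product over positive edges of the ways to split the right total among
`left + 1` half-edges. -/
lemma dynamicKostant_eq_sum (hloop : G.Loopless) (B : Finset (G.HalfEdge → ℕ))
    (hB : ∀ b, b ∈ B ↔ G.IsPartialFlow n b) :
    ((G.dynamicKostant G.shiftedIndeg : ℕ∞) : ℝ≥0∞) = ∑ b ∈ B, ∏ e : {e : E // G.sign e = 1},
      (((b (Sum.inl e.1) + b (Sum.inr e)).choose (b (Sum.inl e.1)) : ℕ) : ℝ≥0∞) := by
  have hfin : ∀ l r : ℕ, Finite {g : Fin (l + 1) → ℕ // ∑ k, g k = r} := fun l r =>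
    Nat.finite_of_card_ne_zero (by
      rw [card_sum_eq]
      exact (Nat.choose_pos (by omega)).ne')
  rw [dynamicKostant, ← ENat.card_congr (Equiv.ofBijective _ (toDynamicFlow_bijective hloop B hB)),
    ENat.card_eq_coe_natCard, Nat.card_sigma, ← Finset.sum_coe_sort B]
  simp_rw [Nat.card_pi, card_sum_eq]
  rw [ENat.toENNReal_coe, Nat.cast_sum]
  exact Finset.sum_congr rfl fun b _ => Nat.cast_prod _ _

end SignedGraph

end

/-! ### Lattice coordinates and slices of the cone. -/

noncomputable section

open MeasureTheory
open scoped Pointwise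

@[simp] lemma intVec_apply {ι : Type*} (u : ι → ℤ) (i : ι) : intVec u i = (u i : ℝ) := rfl

/-- A real linear map that restricts to an isomorphism of the integer lattices is bijective and
preserves Lebesgue measure. -/
lemma measurePreserving_of_intEquiv {κ ι : Type*} [Fintype κ] [Fintype ι]
    (ℓ : (κ → ℤ) ≃ₗ[ℤ] (ι → ℤ)) (L : (κ → ℝ) →ₗ[ℝ] (ι → ℝ))
    (h : ∀ z, L (intVec z) = intVec (ℓ z)) :
    MeasurePreserving L ∧ Function.Surjective L := by
  classical
  have hcard : Fintype.card ι = Fintype.card κ := by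
    have := ℓ.finrank_eq
    rwa [Module.finrank_pi, Module.finrank_pi, eq_comm] at this
  -- Relabelling coordinates preserves volume and makes the map an endomorphism. Its determinant is
  -- then a unit of `ℤ`, hence `±1`.
  let σ : κ ≃ ι := (Fintype.equivOfCardEq hcard).symm
  let ℓ' : (κ → ℤ) ≃ₗ[ℤ] (κ → ℤ) := ℓ ≪≫ₗ LinearEquiv.funCongrLeft ℤ ℤ σ
  let L' : (κ → ℝ) →ₗ[ℝ] (κ → ℝ) := (LinearMap.funLeft ℝ ℝ σ).comp L
  have h1 : LinearMap.toMatrix' L' =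
      (LinearMap.toMatrix' (ℓ' : (κ → ℤ) →ₗ[ℤ] (κ → ℤ))).map (Int.castRingHom ℝ) := by
    ext i j
    rw [LinearMap.toMatrix'_apply, Matrix.map_apply, LinearMap.toMatrix'_apply]
    have h2 : (fun j' => if j' = j then (1 : ℝ) else 0) =
        intVec fun j' => if j' = j then (1 : ℤ) else 0 := by
      funext j'
      rw [intVec_apply]
      split_ifs <;> simp
    have h3 : L' (intVec fun j' => if j' = j then (1 : ℤ) else 0) i =
        intVec (ℓ fun j' => if j' = j then (1 : ℤ) else 0) (σ i) :=
      congrFun (h _) (σ i)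
    have h4 : (Pi.single j 1 : κ → ℝ) = fun j' => if j' = j then (1 : ℝ) else 0 := by
      funext j'; rw [Pi.single_apply]
    have h5 : (Pi.single j 1 : κ → ℤ) = fun j' => if j' = j then (1 : ℤ) else 0 := by
      funext j'; rw [Pi.single_apply]
    rw [h4, h5, h2, h3]
    rfl
  have h2 : |LinearMap.det L'| = 1 := by
    rw [← LinearMap.det_toMatrix', h1, ← RingHom.mapMatrix_apply, ← RingHom.map_det, LinearMap.det_toMatrix']
    rcases Int.isUnit_iff.1 (LinearEquiv.isUnit_det' ℓ') with h | h <;> rw [h] <;> simp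
  have h3 : LinearMap.det L' ≠ 0 := fun h => by rw [h] at h2; simp at h2
  have hmp : MeasurePreserving L' := by
    refine ⟨(LinearMap.continuous_of_finiteDimensional _).measurable, ?_⟩
    rw [Real.map_linearMap_volume_pi_eq_smul_volume_pi h3, abs_inv, h2]
    simp
  have hL : ∀ z, L z = MeasurableEquiv.piCongrLeft (fun _ : ι => ℝ) σ (L' z) := by
    intro z
    funext i
    obtain ⟨j, rfl⟩ := σ.surjective i
    rw [MeasurableEquiv.piCongrLeft_apply_apply]
    rfl
  have hL' : (L : (κ → ℝ) → ι → ℝ) = MeasurableEquiv.piCongrLeft (fun _ : ι => ℝ) σ ∘ L' :=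
    funext hL
  refine ⟨?_, ?_⟩
  · rw [hL']
    exact (volume_measurePreserving_piCongrLeft (fun _ : ι => ℝ) σ).comp hmp
  · rw [hL']
    refine (MeasurableEquiv.surjective _).comp ?_
    rw [← LinearMap.range_eq_top]
    exact LinearMap.range_eq_top.2 (LinearMap.equivOfDetNeZero L' h3).surjective

namespace SignedGraph

variable {n : ℕ} {E : Type*} [Fintype E] {G : SignedGraph n E} {t : Fin (n + 1) → E}

variable (G) in
/-- The module of conserved flows. -/
def conservedFlows (R : Type*) [CommRing R] : Submodule R (E → R) where
  carrier := {f | G.IsConserved f}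
  zero_mem' := fun v _ => by simp
  add_mem' := fun {f g} hf hg v hv => by
    simp only [Pi.add_apply, Finset.sum_add_distrib]
    rw [hf v hv, hg v hv]
  smul_mem' := fun c f hf v hv => by
    simp only [Pi.smul_apply, ← Finset.smul_sum]
    rw [hf v hv]

@[simp] lemma mem_conservedFlows {R : Type*} [CommRing R] {f : E → R} :
    f ∈ G.conservedFlows R ↔ G.IsConserved f := Iff.rfl

variable (G) in
/-- The total flow on the positive edges. -/
def posSum (R : Type*) [CommRing R] : (E → R) →ₗ[R] R :=
  ∑ e ∈ G.posEdges, LinearMap.proj e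

lemma posSum_apply {R : Type*} [CommRing R] (f : E → R) :
    G.posSum R f = ∑ e ∈ G.posEdges, f e := by
  simp [posSum]

lemma isConserved_intVec {u : E → ℤ} : G.IsConserved (intVec u) ↔ G.IsConserved u := by
  refine forall_congr' fun v => imp_congr_right fun _ => ?_
  simp only [intVec_apply]
  exact_mod_cast Iff.rfl

lemma posSum_intVec (u : E → ℤ) : G.posSum ℝ (intVec u) = (G.posSum ℤ u : ℝ) := by
  rw [posSum_apply, posSum_apply]
  push_cast
  rfl

lemma mem_integerPoints_iff {u : E → ℤ} :
    u ∈ integerPoints G.flowSpace ↔ G.IsConserved u ∧ G.posSum ℤ u = 0 := by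
  change intVec u ∈ G.flowSpace ↔ _
  rw [mem_flowSpace_iff, isConserved_intVec, ← posSum_apply, posSum_intVec, Int.cast_eq_zero]

/-- Positive edges are free, so one of them can be given flow 1 and the others 0. Such a `w` splits
the lattice of conserved flows as `ℤ w` plus the netflow-zero lattice. -/
lemma exists_unit_flow (hloop : G.Loopless) (ht : G.IsParentChoice t) {e₀ : E}
    (he₀ : G.sign e₀ = 1) : ∃ w : E → ℤ, G.IsConserved w ∧ G.posSum ℤ w = 1 := by
  classical
  obtain ⟨w, h1, h2⟩ := exists_isConserved hloop ht (Pi.single e₀ (1 : ℤ))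
  refine ⟨w, h2, ?_⟩
  rw [posSum_apply, Finset.sum_congr rfl fun e he =>
    h1 e (ht.mem_freeEdges_of_pos (mem_posEdges.1 he)), Finset.sum_pi_single',
    if_pos (mem_posEdges.2 he₀)]

section Lattice

variable (G) in
/-- The rank of the lattice of integer flows with netflow zero. -/
abbrev flowRank : ℕ := Module.finrank ℤ (integerPoints G.flowSpace)

/-- A lattice basis of the integer flows with netflow zero, preceded by one more vector. -/
def extendedBasis (w : E → ℤ) : Fin (G.flowRank + 1) → E → ℤ :=
  Fin.cons w fun k => (Module.finBasis ℤ (integerPoints G.flowSpace) k : E → ℤ)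

variable {w : E → ℤ}

lemma isConserved_extendedBasis (hw : G.IsConserved w) (i : Fin (G.flowRank + 1)) :
    G.IsConserved (extendedBasis (G := G) w i) := by
  refine Fin.cases hw (fun k => ?_) i
  exact (mem_integerPoints_iff.1 (Module.finBasis ℤ (integerPoints G.flowSpace) k).2).1

lemma posSum_extendedBasis (hw1 : G.posSum ℤ w = 1) (i : Fin (G.flowRank + 1)) :
    G.posSum ℤ (extendedBasis (G := G) w i) = if i = 0 then 1 else 0 := by
  refine Fin.cases hw1 (fun k => ?_) i
  rw [if_neg (Fin.succ_ne_zero k)]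
  exact (mem_integerPoints_iff.1 (Module.finBasis ℤ (integerPoints G.flowSpace) k).2).2

variable (G) in
/-- The integer flow with given coordinates in the extended lattice basis. -/
def intFlow (w : E → ℤ) : (Fin (G.flowRank + 1) → ℤ) →ₗ[ℤ] E → ℤ :=
  Fintype.linearCombination ℤ (extendedBasis (G := G) w)

variable (G) in
/-- The real flow with given coordinates in the extended lattice basis. -/
def realFlow (w : E → ℤ) : (Fin (G.flowRank + 1) → ℝ) →ₗ[ℝ] E → ℝ :=
  Fintype.linearCombination ℝ fun i => intVec (extendedBasis (G := G) w i)

lemma realFlow_intVec (z : Fin (G.flowRank + 1) → ℤ) :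
    G.realFlow w (intVec z) = intVec (G.intFlow w z) := by
  funext e
  simp [realFlow, intFlow, Fintype.linearCombination_apply]

lemma isConserved_intFlow (hw : G.IsConserved w) (z : Fin (G.flowRank + 1) → ℤ) :
    G.IsConserved (G.intFlow w z) := by
  rw [intFlow, Fintype.linearCombination_apply]
  exact (G.conservedFlows ℤ).sum_mem fun i _ =>
    (G.conservedFlows ℤ).smul_mem _ (isConserved_extendedBasis hw i)

lemma isConserved_realFlow (hw : G.IsConserved w) (z : Fin (G.flowRank + 1) → ℝ) :
    G.IsConserved (G.realFlow w z) := by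
  rw [realFlow, Fintype.linearCombination_apply]
  exact (G.conservedFlows ℝ).sum_mem fun i _ =>
    (G.conservedFlows ℝ).smul_mem _ (isConserved_intVec.2 (isConserved_extendedBasis hw i))

lemma posSum_intFlow (hw1 : G.posSum ℤ w = 1) (z : Fin (G.flowRank + 1) → ℤ) :
    G.posSum ℤ (G.intFlow w z) = z 0 := by
  simp [intFlow, Fintype.linearCombination_apply, map_sum, map_smul, posSum_extendedBasis hw1,
    -zsmul_eq_mul]

lemma posSum_realFlow (hw1 : G.posSum ℤ w = 1) (z : Fin (G.flowRank + 1) → ℝ) :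
    G.posSum ℝ (G.realFlow w z) = z 0 := by
  simp [realFlow, Fintype.linearCombination_apply, posSum_intVec, posSum_extendedBasis hw1]

lemma intFlow_cons (a : ℤ) (z : Fin G.flowRank → ℤ) :
    G.intFlow w (Fin.cons a z) =
      a • w + ((∑ k, z k • Module.finBasis ℤ (integerPoints G.flowSpace) k :
        integerPoints G.flowSpace) : E → ℤ) := by
  rw [intFlow, Fintype.linearCombination_apply, Fin.sum_univ_succ, Submodule.coe_sum]
  rfl

lemma realFlow_cons (a : ℝ) (z : Fin G.flowRank → ℝ) :
    G.realFlow w (Fin.cons a z) = a • intVec w +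
      ∑ k, z k • intVec (Module.finBasis ℤ (integerPoints G.flowSpace) k : E → ℤ) := by
  rw [realFlow, Fintype.linearCombination_apply, Fin.sum_univ_succ]
  rfl

/-- Integer values on the free edges extend uniquely to an integer conserved flow `f`, and
subtracting `posSum f` times `w` lands in the netflow-zero lattice. So the free edges and the
extended basis give the same lattice coordinates up to a unimodular change. -/
lemma bijective_restrict_intFlow (hloop : G.Loopless) (ht : G.IsParentChoice t)
    (hw : G.IsConserved w) (hw1 : G.posSum ℤ w = 1) :
    Function.Bijective ((LinearMap.funLeft ℤ ℤ (Subtype.val : G.freeEdges t → E)).comp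
      (G.intFlow w)) := by
  classical
  constructor
  · rw [← LinearMap.ker_eq_bot, LinearMap.ker_eq_bot']
    intro z hz
    have h1 : G.intFlow w z = 0 :=
      (isConserved_intFlow hw z).ext hloop ht (G.conservedFlows ℤ).zero_mem
        fun e he => congrFun hz ⟨e, he⟩
    have h0 : z 0 = 0 := by rw [← posSum_intFlow hw1 z, h1, map_zero]
    rw [← Fin.cons_self_tail z, intFlow_cons, h0, zero_smul, zero_add] at h1
    have h2 := Fintype.linearIndependent_iff.1
      (Module.finBasis ℤ (integerPoints G.flowSpace)).linearIndependent _ (Subtype.ext h1)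
    funext i
    exact Fin.cases h0 h2 i
  · intro y
    obtain ⟨f, h1, h2⟩ := exists_isConserved hloop ht
      fun e => if h : e ∈ G.freeEdges t then y ⟨e, h⟩ else 0
    have h3 : f - G.posSum ℤ f • w ∈ integerPoints G.flowSpace := by
      refine mem_integerPoints_iff.2 ⟨(G.conservedFlows ℤ).sub_mem h2
        ((G.conservedFlows ℤ).smul_mem _ hw), ?_⟩
      rw [map_sub, map_smul, hw1]
      simp
    refine ⟨Fin.cons (G.posSum ℤ f)
      ((Module.finBasis ℤ (integerPoints G.flowSpace)).repr ⟨_, h3⟩), ?_⟩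
    have h4 : G.intFlow w (Fin.cons (G.posSum ℤ f)
        ((Module.finBasis ℤ (integerPoints G.flowSpace)).repr ⟨_, h3⟩)) = f := by
      rw [intFlow_cons, Module.Basis.sum_repr]
      simp
    funext e
    rw [LinearMap.comp_apply, h4, LinearMap.funLeft_apply, h1 _ e.2, dif_pos e.2]

lemma restrict_realFlow (hloop : G.Loopless) (ht : G.IsParentChoice t)
    (hw : G.IsConserved w) (hw1 : G.posSum ℤ w = 1) :
    MeasurePreserving ((LinearMap.funLeft ℝ ℝ (Subtype.val : G.freeEdges t → E)).comp
      (G.realFlow w)) ∧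
    Function.Surjective ((LinearMap.funLeft ℝ ℝ (Subtype.val : G.freeEdges t → E)).comp
      (G.realFlow w)) := by
  refine measurePreserving_of_intEquiv
    (LinearEquiv.ofBijective _ (bijective_restrict_intFlow hloop ht hw hw1)) _ fun z => ?_
  rw [LinearMap.comp_apply, realFlow_intVec]
  rfl

lemma exists_realFlow_eq (hloop : G.Loopless) (ht : G.IsParentChoice t)
    (hw : G.IsConserved w) (hw1 : G.posSum ℤ w = 1) {p : E → ℝ} (hp : G.IsConserved p) :
    ∃ z, G.realFlow w (Fin.cons (G.posSum ℝ p) z) = p := by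
  obtain ⟨z, hz⟩ := (restrict_realFlow hloop ht hw hw1).2
    (LinearMap.funLeft ℝ ℝ (Subtype.val : G.freeEdges t → E) p)
  have h1 : G.realFlow w z = p :=
    (isConserved_realFlow hw z).ext hloop ht hp fun e he => congrFun hz ⟨e, he⟩
  refine ⟨Fin.tail z, ?_⟩
  rw [← h1, posSum_realFlow hw1, Fin.cons_self_tail]

variable (G) in
/-- The coordinates of the nonnegative flows with total flow `a` on the positive edges. -/
def coneSlice (w : E → ℤ) (a : ℝ) : Set (Fin G.flowRank → ℝ) :=
  {z | ∀ e, 0 ≤ G.realFlow w (Fin.cons a z) e}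

lemma measurableSet_coneSlice (a : ℝ) : MeasurableSet (G.coneSlice w a) := by
  rw [coneSlice, Set.ofPred_forall]
  refine MeasurableSet.iInter fun e => measurableSet_le measurable_const ?_
  simp_rw [realFlow_cons]
  fun_prop

/-- For `a > 0` the slice is a dilate of the slice at height 1; for `a < 0` it is empty. Height 0 is
excluded, as it is not a dilate of the slice at 1. -/
lemma volume_coneSlice (hw1 : G.posSum ℤ w = 1) {a : ℝ} (ha : a ≠ 0) :
    volume (G.coneSlice w a) =
      powDensity G.flowRank a * ((G.flowRank ! : ℝ≥0∞) * volume (G.coneSlice w 1)) := by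
  rcases lt_or_gt_of_ne ha with ha | ha
  · rw [powDensity_of_neg _ ha, zero_mul]
    have : G.coneSlice w a = ∅ := by
      refine Set.eq_empty_of_forall_notMem fun z hz => ?_
      have h1 := posSum_realFlow hw1 (Fin.cons a z)
      rw [posSum_apply, Fin.cons_zero] at h1
      have h2 : 0 ≤ ∑ e ∈ G.posEdges, G.realFlow w (Fin.cons a z) e :=
        Finset.sum_nonneg fun e _ => hz e
      linarith
    rw [this, measure_empty]
  · have h1 : G.coneSlice w a = a • G.coneSlice w 1 := by
      ext z
      rw [Set.mem_smul_set_iff_inv_smul_mem₀ ha.ne']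
      refine forall_congr' fun e => ?_
      have h2 : G.realFlow w (Fin.cons a z) =
          a • G.realFlow w (Fin.cons 1 (a⁻¹ • z)) := by
        rw [← map_smul]
        congr 1
        funext i
        refine Fin.cases ?_ (fun k => ?_) i
        · simp
        · simp [ha.ne']
      rw [h2, Pi.smul_apply, smul_eq_mul, mul_nonneg_iff_of_pos_left ha]
    rw [h1, Measure.addHaar_smul, Module.finrank_fin_fun, powDensity_of_nonneg _ ha.le, ← mul_assoc,
      ← ENNReal.ofReal_natCast, ← ENNReal.ofReal_mul (by positivity),
      div_mul_cancel₀ _ (by positivity), abs_of_pos (by positivity)]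

lemma normalizedVolumeIn_flowSpace (hloop : G.Loopless) (ht : G.IsParentChoice t)
    (hw : G.IsConserved w) (hw1 : G.posSum ℤ w = 1) :
    normalizedVolumeIn G.flowSpace (G.flowPolytope (Pi.single 0 2)) =
      (G.flowRank ! : ℝ≥0∞) * volume (G.coneSlice w 1) := by
  have hmem : ∀ z : Fin G.flowRank → ℝ,
      G.realFlow w (Fin.cons 1 z) ∈ G.flowPolytope (Pi.single 0 2) ↔ z ∈ G.coneSlice w 1 := by
    intro z
    rw [mem_flowPolytope_iff, ← posSum_apply, posSum_realFlow hw1]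
    simp [isConserved_realFlow hw, coneSlice]
  rw [normalizedVolumeIn]
  split_ifs with h
  · congr 1
    obtain ⟨-, h1, h2⟩ := mem_flowPolytope_iff.1 h.some_mem
    rw [← posSum_apply] at h2
    obtain ⟨c, hc⟩ := exists_realFlow_eq hloop ht hw hw1 h1
    rw [h2] at hc
    -- The base point chosen by the definition has coordinates `(1, c)`, so the two coordinate sets
    -- differ by translation by `c`.
    rw [← measure_preimage_add volume c (G.coneSlice w 1)]
    congr 1
    ext y
    rw [Set.mem_preimage, ← hmem, Set.mem_ofPred_eq]
    have : h.some + ∑ k, y k • intVec (Module.finBasis ℤ (integerPoints G.flowSpace) k : E → ℤ) =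
        G.realFlow w (Fin.cons 1 (c + y)) := by
      rw [← hc, realFlow_cons, realFlow_cons, add_assoc, ← Finset.sum_add_distrib]
      simp only [Pi.add_apply, add_smul]
    rw [this]
  · have : G.coneSlice w 1 = ∅ := Set.eq_empty_of_forall_notMem fun z hz =>
      h ⟨_, (hmem z).2 hz⟩
    rw [this, measure_empty, mul_zero]

/-- Pass from the free edges to extended lattice coordinates, whose zeroth coordinate is the
positive total, and apply Tonelli to the slices. The factor `r!` hidden in `volume_coneSlice` is
absorbed by the Gamma integral. -/
lemma lmarginal_freeEdges_eq [DecidableEq E] (hloop : G.Loopless) (ht : G.IsParentChoice t)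
    (hw : G.IsConserved w) (hw1 : G.posSum ℤ w = 1) :
    lmarginal (fun _ : E => (volume : Measure ℝ)) (G.freeEdges t) (flowDensity hloop ht 0 0) 0 =
      (G.flowRank ! : ℝ≥0∞) * volume (G.coneSlice w 1) := by
  have hmp := (restrict_realFlow hloop ht hw hw1).1
  have hF : ∀ z, flowDensity hloop ht 0 0 (Function.updateFinset 0 (G.freeEdges t)
      ((LinearMap.funLeft ℝ ℝ (Subtype.val : G.freeEdges t → E)).comp (G.realFlow w) z)) =
      if ∀ e, 0 ≤ G.realFlow w z e then ENNReal.ofReal (Real.exp (-z 0)) else 0 := by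
    intro z
    set y := Function.updateFinset (0 : E → ℝ) (G.freeEdges t)
      ((LinearMap.funLeft ℝ ℝ (Subtype.val : G.freeEdges t → E)).comp (G.realFlow w) z) with hy
    have hyfree : ∀ e ∈ G.freeEdges t, y e = G.realFlow w z e := by
      intro e he
      simp [hy, Function.updateFinset, he, LinearMap.funLeft_apply]
    have h1 : solve hloop ht y = G.realFlow w z :=
      (isConserved_solve y).ext hloop ht (isConserved_realFlow hw z) fun e he => by
        rw [solve_of_mem _ he, hyfree e he]
    have h2 : ∑ e ∈ G.posEdges, y e = z 0 := by
      rw [← posSum_realFlow hw1 z, posSum_apply]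
      exact Finset.sum_congr rfl fun e he =>
        hyfree e (ht.mem_freeEdges_of_pos (mem_posEdges.1 he))
    rw [flowDensity_zero, h1, h2]
  have hmeas := measurable_flowDensity (hloop := hloop) (ht := ht) 0 0
  have h1 := hmp.lintegral_comp (f := fun y => flowDensity hloop ht 0 0
    (Function.updateFinset 0 (G.freeEdges t) y)) (hmeas.comp measurable_updateFinset)
  have h2 := (volume_preserving_piFinSuccAbove (fun _ : Fin (G.flowRank + 1) => ℝ) 0).symm
  have hmeas' : Measurable fun z : Fin (G.flowRank + 1) → ℝ =>
      if ∀ e, 0 ≤ G.realFlow w z e then ENNReal.ofReal (Real.exp (-z 0)) else 0 := by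
    simp_rw [← hF]
    exact (hmeas.comp measurable_updateFinset).comp hmp.measurable
  rw [lmarginal]
  refine h1.symm.trans ?_
  simp_rw [hF]
  rw [← h2.lintegral_comp hmeas']
  change ∫⁻ p : ℝ × (Fin G.flowRank → ℝ), _ ∂(volume.prod volume) = _
  refine (lintegral_prod _ (hmeas'.comp (MeasurableEquiv.piFinSuccAbove
    (fun _ : Fin (G.flowRank + 1) => ℝ) 0).symm.measurable).aemeasurable).trans ?_
  have h3 : ∀ a : ℝ, ∫⁻ z : Fin G.flowRank → ℝ,
      (if ∀ e, 0 ≤ G.realFlow w (Fin.cons a z) e then ENNReal.ofReal (Real.exp (-a)) else 0) =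
      ENNReal.ofReal (Real.exp (-a)) * volume (G.coneSlice w a) := by
    intro a
    rw [← lintegral_indicator_const (measurableSet_coneSlice a)]
    refine lintegral_congr fun z => ?_
    by_cases hz : z ∈ G.coneSlice w a
    · rw [Set.indicator_of_mem hz]
      exact if_pos hz
    · rw [Set.indicator_of_notMem hz]
      exact if_neg hz
  have h4 : ∀ (a : ℝ) (z : Fin G.flowRank → ℝ),
      (MeasurableEquiv.piFinSuccAbove (fun _ : Fin (G.flowRank + 1) => ℝ) 0).symm (a, z) =
        Fin.cons a z := by
    intro a z
    funext i
    exact Fin.cases rfl (fun _ => rfl) i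
  simp only [Function.comp_apply, h4, Fin.cons_zero, h3]
  have h5 : ∀ᵐ a : ℝ, ENNReal.ofReal (Real.exp (-a)) * volume (G.coneSlice w a) =
      ENNReal.ofReal (Real.exp (-a)) * powDensity G.flowRank a *
        ((G.flowRank ! : ℝ≥0∞) * volume (G.coneSlice w 1)) := by
    filter_upwards [Measure.ae_ne volume (0 : ℝ)] with a ha
    rw [volume_coneSlice hw1 ha, mul_assoc]
  rw [lintegral_congr_ae h5, lintegral_mul_const _ (by fun_prop), lintegral_exp_mul_powDensity,
    one_mul]

end Lattice

end SignedGraph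

end

/-! ### Both evaluations combined, the dimension bound, and graphs without positive edges. -/

noncomputable section

namespace SignedGraph

variable {n : ℕ} {E : Type*} [Fintype E] {G : SignedGraph n E} {t : Fin (n + 1) → E}

lemma normalizedVolumeIn_eq_dynamicKostant (hloop : G.Loopless) (ht : G.IsParentChoice t)
    {e₀ : E} (he₀ : G.sign e₀ = 1) :
    normalizedVolumeIn G.flowSpace (G.flowPolytope (Pi.single 0 2)) =
      ((G.dynamicKostant G.shiftedIndeg : ℕ∞) : ℝ≥0∞) := by
  classical
  obtain ⟨w, hw, hw1⟩ := exists_unit_flow hloop ht he₀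
  obtain ⟨B, hB, hsum⟩ := exists_lmarginal_freeEdges (hloop := hloop) (ht := ht)
  rw [normalizedVolumeIn_flowSpace hloop ht hw hw1, ← lmarginal_freeEdges_eq hloop ht hw hw1,
    hsum, dynamicKostant_eq_sum hloop B hB]

lemma vectorSpan_flowPolytope_le :
    vectorSpan ℝ (G.flowPolytope (Pi.single 0 2)) ≤ G.flowSpace := by
  rw [vectorSpan_def, Submodule.span_le]
  rintro _ ⟨p, hp, q, hq, rfl⟩
  obtain ⟨-, hp1, hp2⟩ := mem_flowPolytope_iff.1 hp
  obtain ⟨-, hq1, hq2⟩ := mem_flowPolytope_iff.1 hq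
  refine mem_flowSpace_iff.2 ⟨(G.conservedFlows ℝ).sub_mem hp1 hq1, ?_⟩
  rw [← posSum_apply] at hp2 hq2 ⊢
  change G.posSum ℝ (p - q) = 0
  rw [map_sub, hp2, hq2, sub_self]

/-- Restriction to the `#E - n` free edges is injective on `flowSpace`. It is not surjective,
because the positive edges are free but their total must vanish. -/
lemma finrank_flowSpace_add_lt (hloop : G.Loopless) (ht : G.IsParentChoice t)
    {e₀ : E} (he₀ : G.sign e₀ = 1) :
    Module.finrank ℝ G.flowSpace + n < Fintype.card E := by
  classical
  let restr : G.flowSpace →ₗ[ℝ] (G.freeEdges t → ℝ) :=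
    (LinearMap.funLeft ℝ ℝ (Subtype.val : G.freeEdges t → E)).comp G.flowSpace.subtype
  have hinj : Function.Injective restr := by
    rw [← LinearMap.ker_eq_bot, LinearMap.ker_eq_bot']
    intro f hf
    exact Subtype.ext ((mem_flowSpace_iff.1 f.2).1.ext hloop ht (G.conservedFlows ℝ).zero_mem
      fun e he => congrFun hf ⟨e, he⟩)
  have hne : LinearMap.range restr < ⊤ := by
    rw [lt_top_iff_ne_top]
    intro h
    obtain ⟨f, hf⟩ := LinearMap.range_eq_top.1 h fun e => Pi.single (M := fun _ => ℝ) e₀ 1 e.1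
    have h1 := (mem_flowSpace_iff.1 f.2).2
    rw [Finset.sum_congr rfl fun e he => congrFun hf
      ⟨e, ht.mem_freeEdges_of_pos (mem_posEdges.1 he)⟩, Finset.sum_pi_single',
      if_pos (mem_posEdges.2 he₀)] at h1
    exact one_ne_zero h1
  have h1 := Submodule.finrank_lt hne.ne
  rw [LinearMap.finrank_range_of_inj hinj, Module.finrank_pi, Fintype.card_coe] at h1
  have h2 := card_freeEdges ht
  omega

lemma flowPolytope_eq_empty (h : ∀ e, G.sign e ≠ 1) :
    G.flowPolytope (Pi.single 0 2) = ∅ := by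
  refine Set.eq_empty_of_forall_notMem fun f hf => ?_
  have h1 := (mem_flowPolytope_iff.1 hf).2.2
  rw [Finset.sum_eq_zero fun e he => absurd (mem_posEdges.1 he) (h e)] at h1
  exact zero_ne_one h1

lemma sum_shiftedIndeg (hloop : G.Loopless) (h : ∀ e, G.sign e ≠ 1) :
    ∑ v, G.shiftedIndeg v = (Fintype.card E : ℤ) - n := by
  classical
  have h1 : ∀ v, G.shiftedIndeg v = ((G.inEdges v).card : ℤ) - if v = 0 then 0 else 1 := by
    intro v
    rw [shiftedIndeg, card_inEdges]
    split_ifs with hv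
    · have h3 : G.inEdges 0 = ∅ := Finset.eq_empty_of_forall_notMem fun e he =>
        absurd (vertex_inl_lt hloop he) (Fin.not_lt_zero _)
      rw [hv, ← card_inEdges, h3]
      rfl
    · rfl
  have h2 : ∑ v, (G.inEdges v).card = Fintype.card E := by
    rw [← Finset.card_univ, Finset.card_eq_sum_card_fiberwise (f := G.tgt) (t := Finset.univ)
      fun _ _ => Finset.mem_coe.2 (Finset.mem_univ _)]
    refine Finset.sum_congr rfl fun v _ => congrArg Finset.card ?_
    ext e
    simp [sign_eq_neg_one_iff.2 (h e)]
  rw [Finset.sum_congr rfl fun v _ => h1 v, Finset.sum_sub_distrib, ← Nat.cast_sum, h2,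
    Fin.sum_univ_succ]
  simp [Fin.succ_ne_zero]

/-- Summed over all vertices, each negative edge counts once on either side, so the netflow would
sum to 0; but the sum is `#E - n ≥ 1`. -/
lemma dynamicKostant_eq_zero (hloop : G.Loopless) (h : ∀ e, G.sign e ≠ 1)
    (hcard : n + 1 ≤ Fintype.card E) : G.dynamicKostant G.shiftedIndeg = 0 := by
  have : IsEmpty {e : E // G.sign e = 1} := ⟨fun e => h e.1 e.2⟩
  rw [dynamicKostant, ENat.card_eq_zero_iff_empty]
  refine ⟨fun x => ?_⟩
  have h1 : ∑ v, (_ : ℤ) = ∑ v, _ := Finset.sum_congr rfl fun v _ => x.conservation v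
  simp only [Finset.univ_eq_empty, Finset.sum_empty, Nat.cast_zero, add_zero] at h1
  rw [Finset.sum_add_distrib, ← Nat.cast_sum, ← Nat.cast_sum, Finset.sum_comm,
    Finset.sum_comm (s := Finset.univ (α := Fin (n + 1))), sum_shiftedIndeg hloop h] at h1
  simp only [Finset.sum_ite_eq, Finset.mem_univ, if_true] at h1
  omega

end SignedGraph

end

theorem theorem6p4 {n : ℕ} {E : Type*} [Fintype E] (G : SignedGraph n E)
    (hloop : G.Loopless) (hconn : G.Connected)
    (hin : ∀ i : Fin (n + 1), i ≠ 0 → 1 ≤ G.indeg i)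
    (hcard : n + 1 ≤ Fintype.card E) :
    normalizedVolumeIn G.flowSpace (G.flowPolytope (Pi.single 0 2)) =
        ((G.dynamicKostant G.shiftedIndeg : ℕ∞) : ℝ≥0∞) ∧
    (Module.finrank ℝ (vectorSpan ℝ (G.flowPolytope (Pi.single 0 2))) + (n + 1) =
        Fintype.card E →
      normalizedVolume (G.flowPolytope (Pi.single 0 2)) =
        ((G.dynamicKostant G.shiftedIndeg : ℕ∞) : ℝ≥0∞)) := by
  by_cases hpos : ∃ e, G.sign e = 1
  · obtain ⟨e₀, he₀⟩ := hpos
    obtain ⟨t, ht⟩ := SignedGraph.exists_isParentChoice hin e₀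
    have key := SignedGraph.normalizedVolumeIn_eq_dynamicKostant hloop ht he₀
    refine ⟨key, fun hdim => ?_⟩
    have hlt := SignedGraph.finrank_flowSpace_add_lt hloop ht he₀
    -- The dimension hypothesis makes the span at least as large as the bound on `flowSpace`, so the
    -- two subspaces coincide.
    rw [normalizedVolume, Submodule.eq_of_le_of_finrank_le SignedGraph.vectorSpan_flowPolytope_le
      (by omega), key]
  · push Not at hpos
    rw [SignedGraph.dynamicKostant_eq_zero hloop hpos hcard,
      SignedGraph.flowPolytope_eq_empty hpos]
    simp [normalizedVolume, normalizedVolumeIn]
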